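/- Consider the landing market of a single airport. There is a finite set $A$ of flights and a finite set $S$ of time slots, and each slot $s$ has a capacity $cap(s)\in\mathbb{Z}^+$. Each flight $i$ is an agent with private data: a landing window $W(i)\subseteq S$ and delay costs $c_{is}\ge 0$ for $s\in W(i)$. A landing schedule assigns to every flight a slot of its window, with at most $cap(s)$ flights in each slot $s$. A landing schedule $x$ and prices $p\in\mathbb{R}_{\ge 0}^S$ are an equilibrium if every flight incurs the minimum total cost, i.e. $p_{x(i)}+c_{i x(i)}=\min_{s\in W(i)}(p_s+c_{is})$ for all $i\in A$, and $p_s=0$ for every slot $s$ that is not filled to capacity. There is a mechanism that maps the capacities and the reported windows and delay costs to a schedule $x$ and prices $p$, flight $i$ being charged $p_{x(i)}$, such that, whenever the reported data admit a landing schedule (and otherwise it reports that there is none): (1) $(x,p)$ is an equilibrium for the reported data, and $p$ is the minimum equilibrium price vector, i.e. $p_s\le p'_s$ for all $s\in S$ and every equilibrium price vector $p'$; (2) $x$ has minimum total reported delay cost among all landing schedules, and the charges are the VCG payments: for every flight $i$, $p_{x(i)}=\sum_{j\ne i}c_{j x(j)}-\min_y\sum_{j\ne i}c_{j y(j)}$,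 where $y$ ranges over the landing schedules of $A\setminus\{i\}$. Moreover: (3) the mechanism is incentive compatible in dominant strategies: whatever the other flights report, no flight can lower its incurred cost (the price of its slot plus its true delay cost there, and $+\infty$ if it does not land or lands outside its true window) by misreporting its window or its delay costs; (4) the mechanism is computable combinatorially in strongly polynomial time: a single algorithm computes its outcome using only additions, subtractions and comparisons of numbers, in a number of elementary steps bounded by a polynomial in $|A|+|S|$, independently of the sizes of the capacities and delay costs. -/

import Mathlib

namespace LandingMarket

/-! ## The market for landing slots -/

section Market

variable {A S : Type} [Fintype A] [DecidableEq A] [DecidableEq S]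

/-- The data that the operator of one flight declares: the landing window (the set of time slots in
which the flight can land) and a nonnegative delay cost for every slot of the window. The values of
`delay` outside the window carry no meaning and are used nowhere. -/
structure Report (S : Type) where
  window : Finset S
  delay : S → ℝ
  delay_nonneg : ∀ s ∈ window, 0 ≤ delay s

/-- A landing schedule: every flight is assigned a slot of its window, and no slot `s` receives more
than `cap s` flights. -/
def IsLandingSchedule (cap : S → ℕ+) (R : A → Report S) (x : A → S) : Prop :=
  (∀ i, x i ∈ (R i).window) ∧
    ∀ s, (Finset.univ.filter fun i => x i = s).card ≤ (cap s : ℕ)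

/-- An equilibrium landing schedule `x` with landing prices `p`: prices are nonnegative, every flight
incurs the minimum total cost (price plus delay cost) over its window, and a slot that is not filled
to capacity has price zero. -/
structure IsEquilibrium (cap : S → ℕ+) (R : A → Report S) (x : A → S) (p : S → ℝ) : Prop where
  schedule : IsLandingSchedule cap R x
  price_nonneg : ∀ s, 0 ≤ p s
  min_cost : ∀ i, ∀ s ∈ (R i).window, p (x i) + (R i).delay (x i) ≤ p s + (R i).delay s
  price_zero : ∀ s, (Finset.univ.filter fun i => x i = s).card < (cap s : ℕ) → p s = 0

/-- The prices `p` are equilibrium prices, and every other equilibrium price vector is at least as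
large at all slots simultaneously. -/
def IsMinimumPrices (cap : S → ℕ+) (R : A → Report S) (p : S → ℝ) : Prop :=
  IsLeast {q : S → ℝ | ∃ x : A → S, IsEquilibrium cap R x q} p

/-- The total delay cost of all flights. -/
noncomputable def totalDelay (R : A → Report S) (x : A → S) : ℝ :=
  ∑ i, (R i).delay (x i)

/-- A landing schedule of minimum total delay cost. -/
def IsEfficient (cap : S → ℕ+) (R : A → Report S) (x : A → S) : Prop :=
  IsLandingSchedule cap R x ∧
    ∀ y : A → S, IsLandingSchedule cap R y → totalDelay R x ≤ totalDelay R y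

/-- The reports of all flights but `i`. -/
def others (R : A → Report S) (i : A) : {j : A // j ≠ i} → Report S :=
  fun j => R j

/-- `q` is the VCG (Clarke pivot) payment of flight `i` when the schedule is `x`: the total delay cost
of the other flights in `x`, minus the least total delay cost they could have if `i` were absent. -/
def IsVCGPayment (cap : S → ℕ+) (R : A → Report S) (x : A → S) (i : A) (q : ℝ) : Prop :=
  ∃ y : {j : A // j ≠ i} → S, IsEfficient cap (others R i) y ∧
    q = totalDelay (others R i) (fun j => x j) - totalDelay (others R i) y

end Market

/-! ## Mechanisms -/

/-- What a mechanism announces: a slot for each of the `n` flights and a price for each of the `m`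
slots. Flight `i` pays `price (slot i)`. -/
structure Outcome (n m : ℕ) where
  slot : Fin n → Fin m
  price : Fin m → ℝ

/-- A (direct) mechanism maps the capacities and the reports to an outcome, or to `none`, which means
that it declares that no landing schedule exists. -/
abbrev Mechanism : Type :=
  (n m : ℕ) → (Fin m → ℕ+) → (Fin n → Report (Fin m)) → Option (Outcome n m)

open Classical in
/-- The total cost incurred by flight `i` if its true data are `θ`: the price of its slot plus its true
delay cost, and `⊤` if it does not land, or lands outside its true window. -/
noncomputable def incurredCost {n m : ℕ} (θ : Report (Fin m)) (i : Fin n) :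
    Option (Outcome n m) → WithTop ℝ
  | none => ⊤
  | some o =>
      if o.slot i ∈ θ.window then ((o.price (o.slot i) + θ.delay (o.slot i) : ℝ) : WithTop ℝ) else ⊤

/-- Incentive compatibility in dominant strategies: whatever the other flights report, no flight
(with true data `R i`) can lower its incurred cost by reporting some other window and delay costs. -/
def IsDominantStrategyIC (M : Mechanism) : Prop :=
  ∀ (n m : ℕ) (cap : Fin m → ℕ+) (R : Fin n → Report (Fin m)) (i : Fin n) (r : Report (Fin m)),
    incurredCost (R i) i (M n m cap R) ≤
      incurredCost (R i) i (M n m cap (Function.update R i r))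

/-! ## Combinatorial algorithms and their running time

A random access machine, programmed in a structured language. It has a memory for natural numbers
(indices, counters, capacities) and a memory for real numbers (delay costs, prices); each consists of
arrays with two indices. The only arithmetic is addition, subtraction (truncated on `ℕ`) and
comparison. In particular, a number computed in `t` steps has an absolute value of at most `2 ^ t` times
that of the largest number in the input or in the program, so that for rational input all
intermediate numbers have a length polynomial in `t` and the length of the input. -/

/-- The memory: `nat a i j` and `real a i j` are the entries `(i, j)` of the arrays named `a`. -/
structure Memory where
  nat : ℕ → ℕ → ℕ → ℕ
  real : ℕ → ℕ → ℕ → ℝ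

/-- The memory after writing `v` into a cell for natural numbers. -/
def Memory.setNat (σ : Memory) (a i j v : ℕ) : Memory where
  nat a' i' j' := if a' = a ∧ i' = i ∧ j' = j then v else σ.nat a' i' j'
  real := σ.real

/-- The memory after writing `v` into a cell for real numbers. -/
noncomputable def Memory.setReal (σ : Memory) (a i j : ℕ) (v : ℝ) : Memory where
  nat := σ.nat
  real a' i' j' := if a' = a ∧ i' = i ∧ j' = j then v else σ.real a' i' j'

/-- Expressions for natural numbers; array entries may be addressed indirectly. -/
inductive NatExpr where
  | const (k : ℕ)
  | read (a : ℕ) (i j : NatExpr)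
  | add (e f : NatExpr)
  | sub (e f : NatExpr)

/-- Expressions for real numbers. -/
inductive RealExpr where
  | zero
  | read (a : ℕ) (i j : NatExpr)
  | add (e f : RealExpr)
  | sub (e f : RealExpr)

/-- Tests. -/
inductive Test where
  | natLe (e f : NatExpr)
  | realLe (e f : RealExpr)
  | not (b : Test)
  | and (b c : Test)

namespace NatExpr

/-- The value of an expression. -/
def eval (σ : Memory) : NatExpr → ℕ
  | const k => k
  | read a i j => σ.nat a (i.eval σ) (j.eval σ)
  | add e f => e.eval σ + f.eval σ
  | sub e f => e.eval σ - f.eval σ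

/-- The number of elementary operations in the evaluation of an expression. -/
def ops : NatExpr → ℕ
  | const _ => 1
  | read _ i j => i.ops + j.ops + 1
  | add e f => e.ops + f.ops + 1
  | sub e f => e.ops + f.ops + 1

end NatExpr

namespace RealExpr

/-- The value of an expression. -/
noncomputable def eval (σ : Memory) : RealExpr → ℝ
  | zero => 0
  | read a i j => σ.real a (i.eval σ) (j.eval σ)
  | add e f => e.eval σ + f.eval σ
  | sub e f => e.eval σ - f.eval σ

/-- The number of elementary operations in the evaluation of an expression. -/
def ops : RealExpr → ℕ
  | zero => 1
  | read _ i j => i.ops + j.ops + 1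
  | add e f => e.ops + f.ops + 1
  | sub e f => e.ops + f.ops + 1

end RealExpr

namespace Test

/-- The truth of a test. -/
def Holds (σ : Memory) : Test → Prop
  | natLe e f => e.eval σ ≤ f.eval σ
  | realLe e f => e.eval σ ≤ f.eval σ
  | not b => ¬ b.Holds σ
  | and b c => b.Holds σ ∧ c.Holds σ

/-- The number of elementary operations in the evaluation of a test. -/
def ops : Test → ℕ
  | natLe e f => e.ops + f.ops + 1
  | realLe e f => e.ops + f.ops + 1
  | not b => b.ops + 1
  | and b c => b.ops + c.ops + 1

end Test

/-- Programs. -/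
inductive Program where
  | skip
  | setNat (a : ℕ) (i j e : NatExpr)
  | setReal (a : ℕ) (i j : NatExpr) (e : RealExpr)
  | seq (P Q : Program)
  | ite (b : Test) (P Q : Program)
  | while (b : Test) (P : Program)

/-- `Runs P σ t τ`: started in the memory `σ`, the program `P` halts after exactly `t` elementary steps
with the memory `τ`. -/
inductive Runs : Program → Memory → ℕ → Memory → Prop where
  | skip (σ : Memory) : Runs .skip σ 1 σ
  | setNat (σ : Memory) (a : ℕ) (i j e : NatExpr) :
      Runs (.setNat a i j e) σ (i.ops + j.ops + e.ops + 1)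
        (σ.setNat a (i.eval σ) (j.eval σ) (e.eval σ))
  | setReal (σ : Memory) (a : ℕ) (i j : NatExpr) (e : RealExpr) :
      Runs (.setReal a i j e) σ (i.ops + j.ops + e.ops + 1)
        (σ.setReal a (i.eval σ) (j.eval σ) (e.eval σ))
  | seq {P Q : Program} {σ τ υ : Memory} {t u : ℕ} :
      Runs P σ t τ → Runs Q τ u υ → Runs (.seq P Q) σ (t + u) υ
  | iteTrue {b : Test} {P Q : Program} {σ τ : Memory} {t : ℕ} :
      b.Holds σ → Runs P σ t τ → Runs (.ite b P Q) σ (b.ops + t) τ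
  | iteFalse {b : Test} {P Q : Program} {σ τ : Memory} {t : ℕ} :
      ¬ b.Holds σ → Runs Q σ t τ → Runs (.ite b P Q) σ (b.ops + t) τ
  | whileDone {b : Test} {P : Program} {σ : Memory} :
      ¬ b.Holds σ → Runs (.while b P) σ b.ops σ
  | whileStep {b : Test} {P : Program} {σ τ υ : Memory} {t u : ℕ} :
      b.Holds σ → Runs P σ t τ → Runs (.while b P) τ u υ → Runs (.while b P) σ (b.ops + t + u) υ

open Classical in
/-- The memory that holds the input. Natural numbers: array `0` holds the number of flights at `(0, 0)`
and the number of slots at `(0, 1)`, array `1` holds the capacity of slot `s` at `(0, s)`, array `2` is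
the incidence matrix of the landing windows (flights times slots). Real numbers: array `0` is the
matrix of the declared delay costs. All other cells are zero. -/
noncomputable def inputMemory {n m : ℕ} (cap : Fin m → ℕ+) (R : Fin n → Report (Fin m)) : Memory where
  nat a i j :=
    if a = 0 ∧ i = 0 ∧ j = 0 then n
    else if a = 0 ∧ i = 0 ∧ j = 1 then m
    else if h : a = 1 ∧ i = 0 ∧ j < m then (cap ⟨j, h.2.2⟩ : ℕ)
    else if h : a = 2 ∧ i < n ∧ j < m then
      if (⟨j, h.2.2⟩ : Fin m) ∈ (R ⟨i, h.2.1⟩).window then 1 else 0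
    else 0
  real a i j :=
    if h : a = 0 ∧ i < n ∧ j < m then
      if (⟨j, h.2.2⟩ : Fin m) ∈ (R ⟨i, h.2.1⟩).window then (R ⟨i, h.2.1⟩).delay ⟨j, h.2.2⟩ else 0
    else 0

/-- The memory `τ` displays the result. Natural numbers: array `3` holds at `(0, 0)` the number `1`, or
`0` if there is no outcome; array `4` holds the slot of flight `i` at `(0, i)`. Real numbers: array `1`
holds the price of slot `s` at `(0, s)`. -/
def Displays {n m : ℕ} (τ : Memory) : Option (Outcome n m) → Prop
  | none => τ.nat 3 0 0 = 0
  | some o => τ.nat 3 0 0 = 1 ∧ (∀ i : Fin n, τ.nat 4 0 i = (o.slot i : ℕ)) ∧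
      ∀ s : Fin m, τ.real 1 0 s = o.price s

/-- The mechanism is computed by one program, combinatorially (by additions, subtractions and
comparisons only) and in strongly polynomial time: the number of elementary steps is bounded by a
polynomial in the number of flights plus the number of slots, regardless of the size of the
capacities and the delay costs. -/
def IsCombinatorialStronglyPolynomial (M : Mechanism) : Prop :=
  ∃ (P : Program) (q : Polynomial ℕ),
    ∀ (n m : ℕ) (cap : Fin m → ℕ+) (R : Fin n → Report (Fin m)),
      ∃ (t : ℕ) (τ : Memory), Runs P (inputMemory cap R) t τ ∧
        t ≤ q.eval (n + m) ∧ Displays τ (M n m cap R)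

end LandingMarket

/-!
The mechanism is the Hungarian method, followed by a second search that lowers the prices to the
minimum; both are written in the language of the machine.

An auxiliary slot of capacity zero holds the flights that have not been assigned yet, at no delay
cost but at a price of its own. Throughout, the prices are such that every flight, assigned or
waiting, sits in a slot of minimum total cost, and slots that are not filled have price zero. To
assign one more flight, a search grows the set of reached slots, starting from the unfilled ones:
all prices outside the set are raised by the least slack of a flight that sits outside and has a
slot of the set in its window; that flight becomes indifferent between the two slots, and its slot
is reached (`Search.succ`). If the auxiliary slot is reached, moving the indifferent flights along
the pointers frees a place for a waiting flight (`Augmenting.step`); otherwise Hall's condition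
fails and there is no landing schedule (`Stage.not_feasible`).

When all flights are assigned, the mirror image of the search, from the auxiliary slot, lowers all
prices outside the set of reached slots until another slot becomes tight. A phantom flight that
sits in the auxiliary slot at price zero turns the nonnegativity of prices into one more condition
of minimum cost. This leaves a ranking of the slots, `IsTightRanking`: every slot of positive
price is tight for a flight in a slot of smaller rank. Induction on the rank shows that no
equilibrium prices are lower (`IsEquilibrium.isMinimumPrices`; by complementary slackness all
equilibrium prices support the same efficient schedules). It also shows that, when a flight
leaves, the hole in its slot can be moved, at unchanged costs, to a slot of price zero, so that
the price of the slot is the externality of the flight (`exists_supported_schedule`,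
`IsEquilibrium.isVCGPayment`). Incentive compatibility is then the argument of Vickrey, Clarke and
Groves (`isDominantStrategyIC_of_isValidOutcome`).

Running times need no bookkeeping in the proofs. `Program.cost` is a polynomial, computed from the
text of a program, that bounds the running time if every loop makes at most `B` iterations, and
`Program.Ensures` asserts termination within that bound together with a postcondition. Since every
loop runs over flights, slots, search rounds or ranks, `B = n + m + 1` suffices. What a program
leaves unchanged is also read off from its text (`Runs.agree`).
-/

namespace LandingMarket

open Polynomial

/-! ### A program logic with a built-in time bound -/

namespace Program

/-- A bound, as a polynomial in `B`, for the running time of a program each of whose loops makes at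
most `B` iterations whenever it is entered. -/
noncomputable def cost : Program → ℕ[X]
  | skip => 1
  | setNat _ i j e => C (i.ops + j.ops + e.ops + 1)
  | setReal _ i j e => C (i.ops + j.ops + e.ops + 1)
  | seq P Q => P.cost + Q.cost
  | ite b P Q => C b.ops + P.cost + Q.cost
  | .while b P => (C b.ops + P.cost) * X + C b.ops

/-- The names of the arrays of natural numbers that occur on the left of an assignment. -/
def natWrites : Program → Finset ℕ
  | skip => ∅
  | setNat a _ _ _ => {a}
  | setReal _ _ _ _ => ∅
  | seq P Q => P.natWrites ∪ Q.natWrites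
  | ite _ P Q => P.natWrites ∪ Q.natWrites
  | .while _ P => P.natWrites

/-- The names of the arrays of real numbers that occur on the left of an assignment. -/
def realWrites : Program → Finset ℕ
  | skip => ∅
  | setNat _ _ _ _ => ∅
  | setReal a _ _ _ => {a}
  | seq P Q => P.realWrites ∪ Q.realWrites
  | ite _ P Q => P.realWrites ∪ Q.realWrites
  | .while _ P => P.realWrites

/-- The memories `σ` and `τ` agree on all arrays that `P` never assigns to. -/
structure Agree (P : Program) (σ τ : Memory) : Prop where
  nat : ∀ a, a ∉ P.natWrites → τ.nat a = σ.nat a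
  real : ∀ a, a ∉ P.realWrites → τ.real a = σ.real a

/-- Started in `σ`, the program `P` halts in a memory that satisfies `Φ`, within the time `P.cost`
provides for loops of at most `B` iterations. -/
def Ensures (B : ℕ) (P : Program) (σ : Memory) (Φ : Memory → Prop) : Prop :=
  ∃ t τ, Runs P σ t τ ∧ t ≤ P.cost.eval B ∧ Φ τ

end Program

open Program

@[simp] theorem Memory.nat_setNat_same (σ : Memory) (a i j v : ℕ) :
    (σ.setNat a i j v).nat a i = Function.update (σ.nat a i) j v := by
  funext j'
  by_cases h : j' = j <;> simp [Memory.setNat, Function.update, h]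

@[simp] theorem Memory.nat_setNat_of_ne (σ : Memory) {a a' : ℕ} (i j v : ℕ) (h : a' ≠ a) :
    (σ.setNat a i j v).nat a' = σ.nat a' := by
  funext i' j'
  simp [Memory.setNat, h]

@[simp] theorem Memory.real_setNat (σ : Memory) (a i j v : ℕ) :
    (σ.setNat a i j v).real = σ.real := rfl

@[simp] theorem Memory.real_setReal_same (σ : Memory) (a i j : ℕ) (v : ℝ) :
    (σ.setReal a i j v).real a i = Function.update (σ.real a i) j v := by
  funext j'
  by_cases h : j' = j <;> simp [Memory.setReal, Function.update, h]

@[simp] theorem Memory.real_setReal_of_ne (σ : Memory) {a a' : ℕ} (i j : ℕ) (v : ℝ) (h : a' ≠ a) :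
    (σ.setReal a i j v).real a' = σ.real a' := by
  funext i' j'
  simp [Memory.setReal, h]

@[simp] theorem Memory.nat_setReal (σ : Memory) (a i j : ℕ) (v : ℝ) :
    (σ.setReal a i j v).nat = σ.nat := rfl

theorem Program.Agree.refl (P : Program) (σ : Memory) : P.Agree σ σ := ⟨fun _ _ => rfl, fun _ _ => rfl⟩

theorem Program.Agree.trans {P : Program} {σ τ υ : Memory} (h : P.Agree σ τ) (h' : P.Agree τ υ) :
    P.Agree σ υ :=
  ⟨fun a ha => (h'.nat a ha).trans (h.nat a ha), fun a ha => (h'.real a ha).trans (h.real a ha)⟩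

theorem Program.Agree.nat_eq {P : Program} {σ τ : Memory} (h : P.Agree σ τ) (a : ℕ)
    (ha : decide (a ∈ P.natWrites) = false := by rfl) : τ.nat a = σ.nat a :=
  h.nat a (of_decide_eq_false ha)

theorem Program.Agree.real_eq {P : Program} {σ τ : Memory} (h : P.Agree σ τ) (a : ℕ)
    (ha : decide (a ∈ P.realWrites) = false := by rfl) : τ.real a = σ.real a :=
  h.real a (of_decide_eq_false ha)

/-- The frame property: a run changes only the arrays that the program assigns to. -/
theorem Runs.agree {P : Program} {σ τ : Memory} {t : ℕ} (h : Runs P σ t τ) : P.Agree σ τ := by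
  induction h with
  | skip => exact .refl _ _
  | setNat σ a i j e =>
    exact ⟨fun a' ha' => Memory.nat_setNat_of_ne _ _ _ _ (by simpa [natWrites] using ha'),
      fun _ _ => rfl⟩
  | setReal σ a i j e =>
    exact ⟨fun _ _ => rfl,
      fun a' ha' => Memory.real_setReal_of_ne _ _ _ _ (by simpa [realWrites] using ha')⟩
  | seq _ _ h₁ h₂ =>
    refine ⟨fun a ha => ?_, fun a ha => ?_⟩
    · simp only [natWrites, Finset.mem_union, not_or] at ha
      exact (h₂.nat a ha.2).trans (h₁.nat a ha.1)
    · simp only [realWrites, Finset.mem_union, not_or] at ha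
      exact (h₂.real a ha.2).trans (h₁.real a ha.1)
  | iteTrue _ _ h =>
    refine ⟨fun a ha => ?_, fun a ha => ?_⟩
    · simp only [natWrites, Finset.mem_union, not_or] at ha
      exact h.nat a ha.1
    · simp only [realWrites, Finset.mem_union, not_or] at ha
      exact h.real a ha.1
  | iteFalse _ _ h =>
    refine ⟨fun a ha => ?_, fun a ha => ?_⟩
    · simp only [natWrites, Finset.mem_union, not_or] at ha
      exact h.nat a ha.2
    · simp only [realWrites, Finset.mem_union, not_or] at ha
      exact h.real a ha.2
  | whileDone => exact .refl _ _
  | whileStep _ _ _ h₁ h₂ =>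
    exact ⟨fun a ha => (h₂.nat a ha).trans (h₁.nat a ha),
      fun a ha => (h₂.real a ha).trans (h₁.real a ha)⟩

namespace Program.Ensures

variable {B : ℕ} {P Q : Program} {σ : Memory} {Φ Ψ : Memory → Prop}

/-- The rule of consequence; the new postcondition may use the frame property. -/
theorem imp (h : Ensures B P σ Φ) (hΦ : ∀ τ, P.Agree σ τ → Φ τ → Ψ τ) : Ensures B P σ Ψ := by
  obtain ⟨t, τ, hr, ht, hτ⟩ := h
  exact ⟨t, τ, hr, ht, hΦ τ hr.agree hτ⟩

theorem skip (h : Φ σ) : Ensures B .skip σ Φ :=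
  ⟨1, σ, .skip σ, by simp [cost], h⟩

theorem setNat {a : ℕ} {i j e : NatExpr} (h : Φ (σ.setNat a (i.eval σ) (j.eval σ) (e.eval σ))) :
    Ensures B (.setNat a i j e) σ Φ :=
  ⟨_, _, .setNat σ a i j e, by simp [cost], h⟩

theorem setReal {a : ℕ} {i j : NatExpr} {e : RealExpr}
    (h : Φ (σ.setReal a (i.eval σ) (j.eval σ) (e.eval σ))) :
    Ensures B (.setReal a i j e) σ Φ :=
  ⟨_, _, .setReal σ a i j e, by simp [cost], h⟩

theorem seq (h : Ensures B P σ fun τ => Ensures B Q τ Φ) : Ensures B (.seq P Q) σ Φ := by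
  obtain ⟨t, τ, hr, ht, u, υ, hr', hu, hΦ⟩ := h
  exact ⟨t + u, υ, .seq hr hr', by simpa [cost] using add_le_add ht hu, hΦ⟩

theorem ite {b : Test} (h₁ : b.Holds σ → Ensures B P σ Φ) (h₂ : ¬ b.Holds σ → Ensures B Q σ Φ) :
    Ensures B (.ite b P Q) σ Φ := by
  by_cases hb : b.Holds σ
  · obtain ⟨t, τ, hr, ht, hΦ⟩ := h₁ hb
    exact ⟨b.ops + t, τ, .iteTrue hb hr, by simp [cost]; omega, hΦ⟩
  · obtain ⟨t, τ, hr, ht, hΦ⟩ := h₂ hb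
    exact ⟨b.ops + t, τ, .iteFalse hb hr, by simp [cost]; omega, hΦ⟩

/-- The rule for loops: `v` bounds the number of remaining iterations. -/
theorem loop {b : Test} {I : ℕ → Memory → Prop} {v : ℕ} (hv : v ≤ B) (h₀ : I v σ)
    (h : ∀ v τ, P.Agree σ τ → I v τ → b.Holds τ → Ensures B P τ fun υ => ∃ v' < v, I v' υ) :
    Ensures B (.while b P) σ fun τ => (∃ v', I v' τ) ∧ ¬ b.Holds τ := by
  have key : ∀ v τ, P.Agree σ τ → I v τ → ∃ t υ, Runs (.while b P) τ t υ ∧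
      t ≤ (b.ops + P.cost.eval B) * v + b.ops ∧ ((∃ v', I v' υ) ∧ ¬ b.Holds υ) := by
    intro v
    induction v using Nat.strong_induction_on with
    | _ v ih =>
      intro τ hτ hI
      by_cases hb : b.Holds τ
      · obtain ⟨t, υ, hr, ht, v', hv', hI'⟩ := h v τ hτ hI hb
        obtain ⟨u, ω, hr', hu, hω⟩ := ih v' hv' υ (hτ.trans hr.agree) hI'
        refine ⟨_, ω, .whileStep hb hr hr', ?_, hω⟩
        have : (b.ops + P.cost.eval B) * (v' + 1) ≤ (b.ops + P.cost.eval B) * v :=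
          Nat.mul_le_mul_left _ hv'
        rw [mul_add] at this
        omega
      · exact ⟨_, τ, .whileDone hb, by omega, ⟨v, hI⟩, hb⟩
  obtain ⟨t, τ, hr, ht, hτ⟩ := key v σ (.refl _ _) h₀
  refine ⟨t, τ, hr, ht.trans ?_, hτ⟩
  simp only [cost, eval_add, eval_mul, eval_C, eval_X]
  gcongr

end Program.Ensures

/-- The entry `(0, 0)` of an array. -/
def NatExpr.cell (a : ℕ) : NatExpr := .read a (.const 0) (.const 0)

/-- An entry of the row `0` of an array. -/
def NatExpr.entry (a : ℕ) (e : NatExpr) : NatExpr := .read a (.const 0) e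

@[simp] theorem NatExpr.eval_const (σ : Memory) (k : ℕ) : (const k).eval σ = k := rfl

@[simp] theorem NatExpr.eval_read (σ : Memory) (a : ℕ) (i j : NatExpr) :
    (read a i j).eval σ = σ.nat a (i.eval σ) (j.eval σ) := rfl

@[simp] theorem NatExpr.eval_add (σ : Memory) (e f : NatExpr) :
    (add e f).eval σ = e.eval σ + f.eval σ := rfl

@[simp] theorem NatExpr.eval_cell (σ : Memory) (a : ℕ) : (cell a).eval σ = σ.nat a 0 0 := rfl

@[simp] theorem NatExpr.eval_entry (σ : Memory) (a : ℕ) (e : NatExpr) :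
    (entry a e).eval σ = σ.nat a 0 (e.eval σ) := rfl

@[simp] theorem RealExpr.eval_zero (σ : Memory) : zero.eval σ = 0 := rfl

@[simp] theorem RealExpr.eval_read (σ : Memory) (a : ℕ) (i j : NatExpr) :
    (read a i j).eval σ = σ.real a (i.eval σ) (j.eval σ) := rfl

@[simp] theorem RealExpr.eval_add (σ : Memory) (e f : RealExpr) :
    (add e f).eval σ = e.eval σ + f.eval σ := rfl

@[simp] theorem RealExpr.eval_sub (σ : Memory) (e f : RealExpr) :
    (sub e f).eval σ = e.eval σ - f.eval σ := rfl

@[simp] theorem Test.holds_natLe (σ : Memory) (e f : NatExpr) :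
    (natLe e f).Holds σ ↔ e.eval σ ≤ f.eval σ := Iff.rfl

@[simp] theorem Test.holds_realLe (σ : Memory) (e f : RealExpr) :
    (realLe e f).Holds σ ↔ e.eval σ ≤ f.eval σ := Iff.rfl

@[simp] theorem Test.holds_not (σ : Memory) (b : Test) : b.not.Holds σ ↔ ¬ b.Holds σ := Iff.rfl

@[simp] theorem Test.holds_and (σ : Memory) (b c : Test) :
    (b.and c).Holds σ ↔ b.Holds σ ∧ c.Holds σ := Iff.rfl

/-- A counting loop: `P` is run for the values `0, 1, …` of the counter in the cell `(0, 0)` of the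
array `a`, as long as the counter is below `e`. -/
def Program.forLoop (a : ℕ) (e : NatExpr) (P : Program) : Program :=
  .seq (.setNat a (.const 0) (.const 0) (.const 0))
    (.while (.not (.natLe e (.cell a)))
      (.seq P (.setNat a (.const 0) (.const 0) (.add (.cell a) (.const 1)))))

/-- The rule for counting loops. The invariant `I k` holds when the counter has the value `k`. -/
theorem Program.Ensures.forLoop {B N a : ℕ} {e : NatExpr} {P : Program} {σ : Memory}
    {I : ℕ → Memory → Prop} (hN : N ≤ B)
    (he : ∀ τ, (forLoop a e P).Agree σ τ → e.eval τ = N)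
    (h₀ : I 0 (σ.setNat a 0 0 0))
    (h : ∀ k < N, ∀ τ, (forLoop a e P).Agree σ τ → τ.nat a 0 0 = k → I k τ →
      Ensures B P τ fun υ => I (k + 1) (υ.setNat a 0 0 (k + 1)))
    (ha : decide (a ∈ P.natWrites) = false := by rfl) :
    Ensures B (forLoop a e P) σ (I N) := by
  have hset : (Program.forLoop a e P).Agree σ (σ.setNat a 0 0 0) :=
    ⟨fun a' ha' => Memory.nat_setNat_of_ne _ _ _ _ (by
      simp only [Program.forLoop, natWrites, Finset.mem_union, Finset.mem_singleton] at ha'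
      tauto), fun _ _ => rfl⟩
  refine .seq (.setNat ?_)
  refine (Ensures.loop
    (I := fun v τ => ∃ k, k + v = N ∧ τ.nat a 0 0 = k ∧ I k τ) hN ⟨0, by simp, by simp, h₀⟩ ?_).imp ?_
  · rintro v τ hτ ⟨k, hkv, hk, hI⟩ hb
    have hστ : (Program.forLoop a e P).Agree σ τ := by
      refine hset.trans ⟨fun a' ha' => hτ.nat a' ?_, fun a' ha' => hτ.real a' ?_⟩
      · simp only [Program.forLoop, natWrites, Finset.mem_union, Finset.mem_singleton] at ha' ⊢
        tauto
      · simp only [Program.forLoop, realWrites, Finset.mem_union] at ha' ⊢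
        tauto
    simp only [Test.holds_not, Test.holds_natLe, he τ hστ, NatExpr.eval_cell, hk, not_le] at hb
    refine .seq ((h k hb τ hστ hk hI).imp fun υ hυ hIυ => .setNat ?_)
    have : υ.nat a 0 0 = k := by rw [hυ.nat_eq a ha, hk]
    refine ⟨v - 1, by omega, k + 1, by omega, by simp [this], by simpa [this] using hIυ⟩
  · rintro τ hτ ⟨⟨v, k, hkv, hk, hI⟩, hb⟩
    have hστ : (Program.forLoop a e P).Agree σ τ := by
      refine hset.trans ⟨fun a' ha' => hτ.nat a' ?_, fun a' ha' => hτ.real a' ?_⟩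
      · simp only [Program.forLoop, natWrites, Finset.mem_union, Finset.mem_singleton] at ha' ⊢
        tauto
      · simp only [Program.forLoop, realWrites, Finset.mem_union] at ha' ⊢
        tauto
    simp only [Test.holds_not, Test.holds_natLe, he τ hστ, NatExpr.eval_cell, hk, not_not] at hb
    obtain rfl : k = N := by omega
    exact hI

/-! ### Equilibria with minimum prices -/

section Market

variable {A S : Type} [Fintype A] [DecidableEq S]

/-- The hole left by a flight travels along tight flights, downwards in rank, to a slot of price
zero. Here `x` is the schedule that the ranking belongs to, restricted to the flights that are left,
`z` is the current schedule, and `s` is the slot with the hole: `z` still agrees with `x` on all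
slots of rank below that of `s`. -/
theorem exists_supported_schedule [DecidableEq A] {cap : S → ℕ+} {R : A → Report S} {p : S → ℝ} {ρ : S → ℕ}
    {x : A → S} (r : ℕ) : ∀ (z : A → S) (s : S), ρ s = r →
      (∀ t, ρ t ≤ ρ s → p t = 0 ∨ ∃ j, t ∈ (R j).window ∧ ρ (x j) < ρ t ∧
        p t + (R j).delay t = p (x j) + (R j).delay (x j)) →
      (∀ j, ρ (x j) < ρ s → z j = x j) →
      (∀ j, z j ∈ (R j).window) →
      (∀ j, ∀ t ∈ (R j).window, p (z j) + (R j).delay (z j) ≤ p t + (R j).delay t) →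
      (∀ t, (Finset.univ.filter fun j => z j = t).card + (if t = s then 1 else 0) ≤ (cap t : ℕ)) →
      (∀ t, p t ≠ 0 →
        (Finset.univ.filter fun j => z j = t).card + (if t = s then 1 else 0) = (cap t : ℕ)) →
      ∃ y : A → S, IsLandingSchedule cap R y ∧
        (∀ j, ∀ t ∈ (R j).window, p (y j) + (R j).delay (y j) ≤ p t + (R j).delay t) ∧
        ∀ t, p t ≠ 0 → (Finset.univ.filter fun j => y j = t).card = (cap t : ℕ) := by
  induction r using Nat.strong_induction_on with
  | _ r ih =>
    rintro z s rfl hρ hzx hz hmin hcap hfull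
    rcases hρ s le_rfl with h0 | ⟨j, hj, hlt, heq⟩
    -- a hole in a slot of price zero is harmless
    · refine ⟨z, ⟨hz, fun t => (Nat.le_add_right _ _).trans (hcap t)⟩, hmin, fun t ht => ?_⟩
      have := hfull t ht
      rwa [if_neg (by rintro rfl; exact ht h0), add_zero] at this
    -- otherwise `j` moves into the hole, at no change of cost, and leaves a hole in its own slot
    · have hzj : z j = x j := hzx j hlt
      have hne : x j ≠ s := by
        intro e
        rw [e] at hlt
        exact lt_irrefl _ hlt
      have hcard : ∀ t, (Finset.univ.filter fun i => Function.update z j s i = t).card +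
          (if t = x j then 1 else 0) =
          (Finset.univ.filter fun i => z i = t).card + (if t = s then 1 else 0) := by
        intro t
        simp only [Finset.card_filter]
        rw [← Finset.add_sum_erase _ _ (Finset.mem_univ j),
          ← Finset.add_sum_erase _ _ (Finset.mem_univ j)]
        rw [Finset.sum_congr rfl (g := fun i => if z i = t then 1 else 0)]
        · simp only [Function.update_self, hzj, eq_comm (a := t)]
          omega
        · intro i hi
          rw [Function.update_of_ne (Finset.ne_of_mem_erase hi)]
      refine ih _ hlt (Function.update z j s) (x j) rfl (fun t ht => hρ t (ht.trans hlt.le))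
        ?_ ?_ ?_ ?_ ?_
      · intro i hi
        rw [Function.update_of_ne, hzx i (hi.trans hlt)]
        rintro rfl
        exact lt_irrefl _ hi
      · intro i
        rcases eq_or_ne i j with rfl | hij
        · simpa using hj
        · simpa [Function.update_of_ne hij] using hz i
      · intro i t ht
        rcases eq_or_ne i j with rfl | hij
        · have := hmin i t ht
          rw [hzj] at this
          rw [Function.update_self, heq]
          exact this
        · simpa [Function.update_of_ne hij] using hmin i t ht
      · intro t
        rw [hcard]
        exact hcap t
      · intro t ht
        rw [hcard]
        exact hfull t ht

theorem sum_others [DecidableEq A] (i : A) (f : A → ℝ) :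
    ∑ j : {j : A // j ≠ i}, f j = ∑ j, f j - f i := by
  rw [← Finset.add_sum_erase _ _ (Finset.mem_univ i), add_sub_cancel_left]
  rw [← Finset.sum_subtype (Finset.univ.erase i) (by simp)]

theorem card_others [DecidableEq A] (i : A) (x : A → S) (s : S) :
    (Finset.univ.filter fun j : {j : A // j ≠ i} => x j = s).card + (if s = x i then 1 else 0) =
      (Finset.univ.filter fun j => x j = s).card := by
  simp only [Finset.card_filter]
  rw [← Finset.add_sum_erase Finset.univ _ (Finset.mem_univ i),
    Finset.sum_subtype (F := inferInstance) (Finset.univ.erase i) (p := fun j => j ≠ i) (by simp)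
      (fun j => if x j = s then 1 else 0), add_comm]
  simp only [eq_comm (a := s)]

variable [Fintype S]

theorem sum_price_eq (p : S → ℝ) (x : A → S) :
    ∑ i, p (x i) = ∑ s, ((Finset.univ.filter fun i => x i = s).card : ℝ) * p s := by
  rw [← Finset.sum_fiberwise Finset.univ x]
  refine Finset.sum_congr rfl fun s _ => ?_
  rw [Finset.sum_congr rfl (g := fun _ => p s), Finset.sum_const, nsmul_eq_mul]
  intro i hi
  rw [(Finset.mem_filter.1 hi).2]

theorem sum_price_le {cap : S → ℕ+} {R : A → Report S} {p : S → ℝ} {y : A → S} (hp : ∀ s, 0 ≤ p s)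
    (hy : IsLandingSchedule cap R y) : ∑ i, p (y i) ≤ ∑ s, ((cap s : ℕ) : ℝ) * p s := by
  rw [sum_price_eq]
  gcongr with s
  · exact hp s
  · exact hy.2 s

/-- Complementary slackness: at an equilibrium the charges add up to the value of all capacities. -/
theorem IsEquilibrium.sum_price {cap : S → ℕ+} {R : A → Report S} {x : A → S} {p : S → ℝ}
    (h : IsEquilibrium cap R x p) : ∑ i, p (x i) = ∑ s, ((cap s : ℕ) : ℝ) * p s := by
  rw [sum_price_eq]
  refine Finset.sum_congr rfl fun s _ => ?_
  rcases (h.schedule.2 s).lt_or_eq with hs | hs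
  · simp [h.price_zero s hs]
  · rw [hs]

theorem IsEquilibrium.isEfficient {cap : S → ℕ+} {R : A → Report S} {x : A → S} {p : S → ℝ}
    (h : IsEquilibrium cap R x p) : IsEfficient cap R x := by
  refine ⟨h.schedule, fun y hy => ?_⟩
  have h₁ : ∑ i, (p (x i) + (R i).delay (x i)) ≤ ∑ i, (p (y i) + (R i).delay (y i)) :=
    Finset.sum_le_sum fun i _ => h.min_cost i _ (hy.1 i)
  rw [Finset.sum_add_distrib, Finset.sum_add_distrib, h.sum_price] at h₁
  have h₂ := sum_price_le h.price_nonneg hy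
  unfold totalDelay
  linarith

/-- Equilibrium prices support every efficient schedule, not only the one they come with. -/
theorem IsEquilibrium.min_cost_of_isEfficient {cap : S → ℕ+} {R : A → Report S} {x y : A → S}
    {q : S → ℝ} (h : IsEquilibrium cap R y q) (hx : IsEfficient cap R x) (i : A) (s : S)
    (hs : s ∈ (R i).window) : q (x i) + (R i).delay (x i) ≤ q s + (R i).delay s := by
  have hle : ∀ i ∈ Finset.univ, q (y i) + (R i).delay (y i) ≤ q (x i) + (R i).delay (x i) :=
    fun i _ => h.min_cost i _ (hx.1.1 i)
  have heq : ∑ i, (q (y i) + (R i).delay (y i)) = ∑ i, (q (x i) + (R i).delay (x i)) := by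
    refine le_antisymm (Finset.sum_le_sum hle) ?_
    rw [Finset.sum_add_distrib, Finset.sum_add_distrib, h.sum_price]
    exact add_le_add (sum_price_le h.price_nonneg hx.1) (hx.2 y h.schedule)
  rw [← (Finset.sum_eq_sum_iff_of_le hle).1 heq i (Finset.mem_univ i)]
  exact h.min_cost i s hs

/-- A certificate that the prices `p`, which support the schedule `x`, cannot be lowered: every slot
of positive price is tight for some flight that sits in a slot of smaller rank. Following these
flights leads from any slot to a slot of price zero. -/
def IsTightRanking (R : A → Report S) (x : A → S) (p : S → ℝ) (ρ : S → ℕ) : Prop :=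
  ∀ s, p s = 0 ∨ ∃ j, s ∈ (R j).window ∧ ρ (x j) < ρ s ∧
    p s + (R j).delay s = p (x j) + (R j).delay (x j)

theorem IsEquilibrium.isMinimumPrices {cap : S → ℕ+} {R : A → Report S} {x : A → S} {p : S → ℝ}
    {ρ : S → ℕ} (h : IsEquilibrium cap R x p) (hρ : IsTightRanking R x p ρ) :
    IsMinimumPrices cap R p := by
  refine ⟨⟨x, h⟩, ?_⟩
  rintro q ⟨y, hy⟩ s
  have key : ∀ r s, ρ s = r → p s ≤ q s := by
    intro r
    induction r using Nat.strong_induction_on with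
    | _ r ih =>
      rintro s rfl
      rcases hρ s with h0 | ⟨j, hj, hlt, heq⟩
      · rw [h0]
        exact hy.price_nonneg s
      · have h₁ := ih _ hlt _ rfl
        have h₂ := hy.min_cost_of_isEfficient h.isEfficient j s hj
        linarith
  exact key _ s rfl

/-- At minimum equilibrium prices every flight pays its externality: the flights that remain when
`i` leaves can be rearranged, at the same prices, so that all capacities of positive price are used
again, and the rearranged schedule is efficient for them. -/
theorem IsEquilibrium.isVCGPayment [DecidableEq A] {cap : S → ℕ+} {R : A → Report S} {x : A → S} {p : S → ℝ}
    {ρ : S → ℕ} (h : IsEquilibrium cap R x p) (hρ : IsTightRanking R x p ρ) (i : A) :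
    IsVCGPayment cap R x i (p (x i)) := by
  obtain ⟨y, hy, hmin, hfull⟩ := exists_supported_schedule (cap := cap) (R := others R i) (p := p)
    (ρ := ρ) (x := fun j => x j) (ρ (x i)) (fun j => x j) (x i) rfl
    (fun t ht => by
      rcases hρ t with h0 | ⟨j, hj, hlt, heq⟩
      · exact .inl h0
      · refine .inr ⟨⟨j, ?_⟩, hj, hlt, heq⟩
        rintro rfl
        exact absurd (hlt.trans_le ht) (lt_irrefl _))
    (fun _ _ => rfl) (fun j => h.schedule.1 j) (fun j t ht => h.min_cost j t ht)
    (fun t => by rw [card_others]; exact h.schedule.2 t)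
    (fun t ht => by
      rw [card_others]
      by_contra hne
      exact ht (h.price_zero t (lt_of_le_of_ne (h.schedule.2 t) hne)))
  have hyeq : IsEquilibrium cap (others R i) y p := by
    refine ⟨hy, h.price_nonneg, hmin, fun s hs => ?_⟩
    by_contra h0
    exact hs.ne (hfull s h0)
  refine ⟨y, hyeq.isEfficient, ?_⟩
  have h₁ : ∑ j : {j : A // j ≠ i}, (p (y j) + (R j).delay (y j)) =
      ∑ j : {j : A // j ≠ i}, (p (x j) + (R j).delay (x j)) :=
    Finset.sum_congr rfl fun j _ =>
      le_antisymm (hmin j _ (h.schedule.1 j)) (h.min_cost j _ (hy.1 j))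
  rw [Finset.sum_add_distrib, Finset.sum_add_distrib, hyeq.sum_price,
    sum_others i fun j => p (x j), h.sum_price] at h₁
  simp only [totalDelay, others]
  linarith

end Market

/-! ### Incentive compatibility -/

/-- The announcement is correct for the reports: an efficient equilibrium with minimum prices that are
VCG payments, or the statement that there is no landing schedule. -/
def IsValidOutcome {n m : ℕ} (cap : Fin m → ℕ+) (R : Fin n → Report (Fin m)) :
    Option (Outcome n m) → Prop
  | none => ¬ ∃ x : Fin n → Fin m, IsLandingSchedule cap R x
  | some o => IsEquilibrium cap R o.slot o.price ∧ IsMinimumPrices cap R o.price ∧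
      IsEfficient cap R o.slot ∧ ∀ i, IsVCGPayment cap R o.slot i (o.price (o.slot i))

theorem IsVCGPayment.eq {A S : Type} [Fintype A] [DecidableEq A] [DecidableEq S] {cap : S → ℕ+}
    {R : A → Report S} {x : A → S} {i : A} {q : ℝ} (h : IsVCGPayment cap R x i q)
    {y : {j : A // j ≠ i} → S} (hy : IsEfficient cap (others R i) y) :
    q = totalDelay (others R i) (fun j => x j) - totalDelay (others R i) y := by
  obtain ⟨y', hy', rfl⟩ := h
  rw [le_antisymm (hy.2 _ hy'.1) (hy'.2 _ hy.1)]

/-- The Groves argument: with VCG payments, the incurred cost of a flight is the total true delay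
cost of the schedule plus an amount that does not depend on its report. -/
theorem isDominantStrategyIC_of_isValidOutcome {M : Mechanism}
    (hM : ∀ n m (cap : Fin m → ℕ+) (R : Fin n → Report (Fin m)),
      IsValidOutcome cap R (M n m cap R)) : IsDominantStrategyIC M := by
  intro n m cap R i r
  have h := hM n m cap R
  have h' := hM n m cap (Function.update R i r)
  cases ho' : M n m cap (Function.update R i r) with
  | none => simp [incurredCost]
  | some o' =>
    rw [ho'] at h'
    obtain ⟨h'eq, -, -, h'vcg⟩ := h'
    by_cases hw : o'.slot i ∈ (R i).window
    · have hsched : IsLandingSchedule cap R o'.slot := by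
        refine ⟨fun j => ?_, h'eq.schedule.2⟩
        rcases eq_or_ne j i with rfl | hj
        · exact hw
        · simpa [Function.update_of_ne hj] using h'eq.schedule.1 j
      cases ho : M n m cap R with
      | none =>
        rw [ho] at h
        exact absurd ⟨_, hsched⟩ h
      | some o =>
        rw [ho] at h
        obtain ⟨heq, -, heff, hvcg⟩ := h
        obtain ⟨y, hy, hpay⟩ := hvcg i
        have hoth : others (Function.update R i r) i = others R i := by
          funext j
          simp [others, Function.update_of_ne j.2]
        have hpay' := (h'vcg i).eq (y := y) (by rwa [hoth])
        rw [hoth] at hpay'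
        have hle := heff.2 _ hsched
        simp only [incurredCost, heq.schedule.1 i, hw, if_true]
        rw [WithTop.coe_le_coe, hpay, hpay']
        simp only [totalDelay, others] at hle ⊢
        rw [sum_others i fun j => (R j).delay (o.slot j),
          sum_others i fun j => (R j).delay (o'.slot j)]
        linarith
    · simp [incurredCost, hw]

/-! ### The Hungarian method on arrays -/

/-- The number of flights below `n` in slot `s`. -/
def load (n : ℕ) (x : ℕ → ℕ) (s : ℕ) : ℕ := ((Finset.range n).filter fun i => x i = s).card

/-- By how much the cost of flight `j` in slot `t` exceeds its cost in its own slot. -/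
def slack (c : ℕ → ℕ → ℝ) (x : ℕ → ℕ) (p : ℕ → ℝ) (j t : ℕ) : ℝ :=
  (p t + c j t) - (p (x j) + c j (x j))

/-- Every flight below `N` sits in a slot of minimum total cost. -/
def Supports (N m : ℕ) (W : ℕ → ℕ → ℕ) (c : ℕ → ℕ → ℝ) (x : ℕ → ℕ) (p : ℕ → ℝ) : Prop :=
  ∀ j < N, ∀ t < m, 1 ≤ W j t → 0 ≤ slack c x p j t

/-- The end at which the pair of a flight `j` and a slot `t` enlarges the set of reached slots: when
prices go up, the slot that `j` leaves; when prices go down, the slot `t`. -/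
def newSlot (up : Bool) (x : ℕ → ℕ) (j t : ℕ) : ℕ := bif up then x j else t

/-- The amount `a` raised or lowered by `δ`. -/
def shift (up : Bool) (a δ : ℝ) : ℝ := bif up then a + δ else a - δ

/-- The flight `j` and the slot `t` of its window connect a slot outside the set of reached slots (the
support of `F`) with a slot inside. -/
def IsCandidate (up : Bool) (N m : ℕ) (W : ℕ → ℕ → ℕ) (x F : ℕ → ℕ) (j t : ℕ) : Prop :=
  j < N ∧ t < m ∧ 1 ≤ W j t ∧ F (newSlot up x j t) = 0 ∧ 1 ≤ F (newSlot (!up) x j t)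

/-- The state of a search after `r` rounds. It started from the set `F₀` of slots and the prices
`p₀`, and has reached the set `F`, with prices `p` that have changed in one direction and only
outside the current set. A slot `s` in `F` but not in `F₀` is the new end of a tight pair, of the
flight `pf s` and the slot `pt s`, whose other end has been reached before, as the rank `ρ` shows.
-/
structure Search (up : Bool) (N m : ℕ) (W : ℕ → ℕ → ℕ) (c : ℕ → ℕ → ℝ) (x F₀ : ℕ → ℕ) (p₀ : ℕ → ℝ)
    (r : ℕ) (F : ℕ → ℕ) (p : ℕ → ℝ) (pf pt ρ : ℕ → ℕ) : Prop where
  supports : Supports N m W c x p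
  seed : ∀ s, 1 ≤ F₀ s → 1 ≤ F s
  seed_price : ∀ s, 1 ≤ F₀ s → p s = p₀ s
  price_up : up = true → ∀ s, p₀ s ≤ p s
  price_down : up = false → ∀ s, p s ≤ p₀ s
  pointer : ∀ s, 1 ≤ F s → F₀ s = 0 → pf s < N ∧ pt s < m ∧ 1 ≤ W (pf s) (pt s) ∧
    newSlot up x (pf s) (pt s) = s ∧ 1 ≤ F (newSlot (!up) x (pf s) (pt s)) ∧
    slack c x p (pf s) (pt s) = 0 ∧ ρ (newSlot (!up) x (pf s) (pt s)) < ρ s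
  rank_le : ∀ s, ρ s ≤ r
  progress : r ≤ ((Finset.range (m + 1)).filter fun s => 1 ≤ F s).card ∨
    ∀ j t, ¬ IsCandidate up N m W x F j t

theorem Search.start {up : Bool} {N m : ℕ} {W : ℕ → ℕ → ℕ} {c : ℕ → ℕ → ℝ} {x F : ℕ → ℕ} {p : ℕ → ℝ}
    (pf pt : ℕ → ℕ) (h : Supports N m W c x p) :
    Search up N m W c x F p 0 F p pf pt fun _ => 0 where
  supports := h
  seed _ hs := hs
  seed_price _ _ := rfl
  price_up _ _ := le_rfl
  price_down _ _ := le_rfl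
  pointer s hs hs' := by omega
  rank_le _ := le_rfl
  progress := .inl (Nat.zero_le _)

section

variable {up : Bool} {N m : ℕ} {W : ℕ → ℕ → ℕ} {c : ℕ → ℕ → ℝ} {x F₀ : ℕ → ℕ} {p₀ : ℕ → ℝ}
  {r : ℕ} {F : ℕ → ℕ} {p : ℕ → ℝ} {pf pt ρ : ℕ → ℕ}

theorem Search.succ_of_closed (h : Search up N m W c x F₀ p₀ r F p pf pt ρ)
    (hF : ∀ j t, ¬ IsCandidate up N m W x F j t) :
    Search up N m W c x F₀ p₀ (r + 1) F p pf pt ρ :=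
  { h with
    rank_le := fun s => (h.rank_le s).trans (Nat.le_succ r)
    progress := .inr hF }

/-- After `m + 1` rounds the search is exhausted, because each round reaches another slot. -/
theorem Search.closed (h : Search up N m W c x F₀ p₀ (m + 1) F p pf pt ρ)
    (hx : ∀ j < N, x j ≤ m) (j t : ℕ) : ¬ IsCandidate up N m W x F j t := by
  rcases h.progress with hc | hc
  · rintro ⟨hj, ht, -, h0, -⟩
    have heq := Finset.eq_of_subset_of_card_le (Finset.filter_subset (fun s => 1 ≤ F s) _)
      (by rwa [Finset.card_range])
    have hmem : newSlot up x j t ∈ (Finset.range (m + 1)).filter fun s => 1 ≤ F s := by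
      rw [heq, Finset.mem_range]
      have := hx j hj
      cases up <;> simp [newSlot] <;> omega
    have := (Finset.mem_filter.1 hmem).2
    omega
  · exact hc j t

/-- One round of the search. All prices outside `F` are shifted by the least slack `δ` of a candidate
pair, which keeps all flights in slots of minimum cost; that pair becomes tight, and its new end is
added to `F`. -/
theorem Search.succ (h : Search up N m W c x F₀ p₀ r F p pf pt ρ) (hx : ∀ j < N, x j ≤ m)
    {bj bt : ℕ} {δ : ℝ} (hb : IsCandidate up N m W x F bj bt) (hδ : δ = slack c x p bj bt)
    (hmin : ∀ j t, IsCandidate up N m W x F j t → δ ≤ slack c x p j t) :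
    Search up N m W c x F₀ p₀ (r + 1) (Function.update F (newSlot up x bj bt) 1)
      (fun s => if s < m + 1 ∧ F s = 0 then shift up (p s) δ else p s)
      (Function.update pf (newSlot up x bj bt) bj) (Function.update pt (newSlot up x bj bt) bt)
      (Function.update ρ (newSlot up x bj bt) (r + 1)) := by
  have hbc := hb
  obtain ⟨hbj, hbt, hbW, hbn, hbo⟩ := hb
  have hδ0 : 0 ≤ δ := hδ ▸ h.supports bj hbj bt hbt hbW
  have hxb := hx bj hbj
  -- the other end of the pair is in `F`, hence different from `u`, and its price does not change
  set u := newSlot up x bj bt with hu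
  have hF' : ∀ s, 1 ≤ F s → 1 ≤ Function.update F u 1 s := by
    intro s hs
    rcases eq_or_ne s u with rfl | hsu
    · simp
    · simpa [Function.update_of_ne hsu] using hs
  refine ⟨?_, fun s hs => hF' s (h.seed s hs), ?_, ?_, ?_, ?_, ?_, ?_⟩
  · intro j hj t ht hW
    have h₁ := h.supports j hj t ht hW
    have h₂ := hmin j t
    have hxj : x j < m + 1 := Nat.lt_succ_of_le (hx j hj)
    have htm : t < m + 1 := by omega
    rcases Nat.eq_zero_or_pos (F (x j)) with hFx | hFx <;>
      rcases Nat.eq_zero_or_pos (F t) with hFt | hFt <;> cases up <;>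
      simp [slack, shift, IsCandidate, newSlot, hFx, hFt, hxj, htm, hj, ht, hW, Nat.pos_iff_ne_zero.1,
        Nat.succ_le_iff] at * <;> simp_all [Nat.pos_iff_ne_zero] <;> linarith
  · intro s hs
    have := h.seed s hs
    rw [if_neg (by omega)]
    exact h.seed_price s hs
  · rintro rfl s
    have := h.price_up rfl s
    simp only [shift, cond_true]
    split_ifs <;> linarith
  · rintro rfl s
    have := h.price_down rfl s
    simp only [shift, cond_false]
    split_ifs <;> linarith
  · intro s hs hs0
    rcases eq_or_ne s u with rfl | hsu
    · have hne : newSlot (!up) x bj bt ≠ u := by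
        intro e
        rw [e] at hbo
        omega
      have hρ := h.rank_le (newSlot (!up) x bj bt)
      simp only [Function.update_self, Function.update_of_ne hne]
      refine ⟨hbj, hbt, hbW, hu.symm, hbo, ?_, by omega⟩
      have htm : bt < m + 1 := by omega
      have hxm : x bj < m + 1 := by omega
      cases up <;> simp only [newSlot, Bool.not_false, Bool.not_true, cond_true, cond_false] at hbn hbo hu
      · rw [hu] at hbn
        simp only [slack, shift, hbn, htm, Nat.one_le_iff_ne_zero.1 hbo, and_true, and_false, if_true,
          if_false, cond_false] at hδ ⊢
        linarith
      · rw [hu] at hbn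
        simp only [slack, shift, hbn, hxm, Nat.one_le_iff_ne_zero.1 hbo, and_true, and_false, if_true,
          if_false, cond_true] at hδ ⊢
        linarith
    · rw [Function.update_of_ne hsu] at hs
      obtain ⟨h1, h2, h3, h4, h5, h6, h7⟩ := h.pointer s hs hs0
      have hne : newSlot (!up) x (pf s) (pt s) ≠ u := by
        intro e
        rw [e] at h5
        omega
      simp only [Function.update_of_ne hsu, Function.update_of_ne hne]
      refine ⟨h1, h2, h3, h4, h5, ?_, h7⟩
      rw [← h4] at hs
      have hxF : F (x (pf s)) ≠ 0 := by
        cases up <;> simp [newSlot] at hs h5 <;> omega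
      have htF : F (pt s) ≠ 0 := by
        cases up <;> simp [newSlot] at hs h5 <;> omega
      simpa [slack, hxF, htF] using h6
  · intro s
    have := h.rank_le s
    rcases eq_or_ne s u with rfl | hsu
    · simp
    · rw [Function.update_of_ne hsu]
      omega
  · left
    rcases h.progress with hc | hc
    · have hum : u ∈ Finset.range (m + 1) := by
        rw [Finset.mem_range]
        cases up <;> simp [hu, newSlot] <;> omega
      have hnot : u ∉ (Finset.range (m + 1)).filter fun s => 1 ≤ F s := by
        simp [hbn]
      refine (Nat.succ_le_succ hc).trans ?_
      rw [← Nat.succ_eq_add_one, Nat.succ_eq_add_one, ← Finset.card_insert_of_notMem hnot]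
      refine Finset.card_le_card fun s hs => ?_
      rcases Finset.mem_insert.1 hs with rfl | hs
      · simpa using hum
      · rw [Finset.mem_filter] at hs ⊢
        exact ⟨hs.1, hF' s hs.2⟩
    · exact absurd hbc (hc bj bt)

end

/-- The state of the Hungarian method after `k` flights have been assigned to slots. The other flights
wait in the auxiliary slot `m`, which has its own price. -/
structure Stage (n m : ℕ) (cap : ℕ → ℕ) (W : ℕ → ℕ → ℕ) (c : ℕ → ℕ → ℝ) (k : ℕ) (x : ℕ → ℕ)
    (p : ℕ → ℝ) (L : ℕ → ℕ) : Prop where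
  slot_le : ∀ i < n, x i ≤ m
  window : ∀ i < n, x i < m → 1 ≤ W i (x i)
  load_eq : ∀ s < m, L s = load n x s
  load_le : ∀ s < m, L s ≤ cap s
  waiting : load n x m + k = n
  price_nonneg : ∀ s, 0 ≤ p s
  price_zero : ∀ s < m, L s < cap s → p s = 0
  supports : Supports n m W c x p

/-- At the start all flights wait, and all prices are zero; this is where delay costs have to be
nonnegative. -/
theorem Stage.start {n m : ℕ} {cap : ℕ → ℕ} {W : ℕ → ℕ → ℕ} {c : ℕ → ℕ → ℝ} {x : ℕ → ℕ}
    (hx : ∀ i < n, x i = m) (hc : ∀ i < n, c i m = 0)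
    (hc0 : ∀ i < n, ∀ s < m, 1 ≤ W i s → 0 ≤ c i s) :
    Stage n m cap W c 0 x (fun _ => 0) (fun _ => 0) := by
  refine ⟨fun i hi => (hx i hi).le, fun i hi h => absurd (hx i hi) h.ne, fun s hs => ?_,
    fun _ _ => Nat.zero_le _, ?_, fun _ => le_rfl, fun _ _ _ => rfl, fun j hj t ht hW => ?_⟩
  · rw [eq_comm, load, Finset.card_eq_zero, Finset.filter_eq_empty_iff]
    intro i hi
    rw [hx i (Finset.mem_range.1 hi)]
    exact hs.ne'
  · rw [load, Finset.filter_true_of_mem fun i hi => hx i (Finset.mem_range.1 hi)]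
    simp
  · simpa [slack, hx j hj, hc j hj] using hc0 j hj t ht hW

/-- There is a landing schedule for the data in the arrays. -/
def Feasible (n m : ℕ) (cap : ℕ → ℕ) (W : ℕ → ℕ → ℕ) : Prop :=
  ∃ y : ℕ → ℕ, (∀ i < n, y i < m ∧ 1 ≤ W i (y i)) ∧ ∀ s < m, load n y s ≤ cap s

theorem load_update {n j : ℕ} (hj : j < n) (x : ℕ → ℕ) (t s : ℕ) :
    load n (Function.update x j t) s + (if s = x j then 1 else 0) =
      load n x s + (if s = t then 1 else 0) := by
  simp only [load, Finset.card_filter]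
  rw [← Finset.add_sum_erase _ _ (Finset.mem_range.2 hj),
    ← Finset.add_sum_erase _ _ (Finset.mem_range.2 hj),
    Finset.sum_congr rfl (g := fun i => if x i = s then 1 else 0)]
  · simp only [Function.update_self, eq_comm (a := s)]
    omega
  · intro i hi
    rw [Function.update_of_ne (Finset.ne_of_mem_erase hi)]

section

variable {n m : ℕ} {cap : ℕ → ℕ} {W : ℕ → ℕ → ℕ} {c : ℕ → ℕ → ℝ} {k : ℕ} {x : ℕ → ℕ}
  {p₀ p : ℕ → ℝ} {L F₀ F pf pt ρ : ℕ → ℕ}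

/-- If the search from the unfilled slots is exhausted without reaching the auxiliary slot, then Hall's
condition fails: the flights in slots that were not reached, among them a waiting one, have only such
slots in their windows, and these are full. -/
theorem Stage.not_feasible (h : Stage n m cap W c k x p₀ L) (hk : k < n)
    (hF₀ : ∀ s < m, L s < cap s → 1 ≤ F₀ s) (hseed : ∀ s, 1 ≤ F₀ s → 1 ≤ F s)
    (hF : ∀ j t, ¬ IsCandidate true n m W x F j t) (hm : F m = 0) : ¬ Feasible n m cap W := by
  rintro ⟨y, hy, hcap⟩
  have hmem : ∀ i ∈ (Finset.range n).filter fun i => F (x i) = 0,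
      y i ∈ (Finset.range m).filter fun s => F s = 0 := by
    intro i hi
    rw [Finset.mem_filter, Finset.mem_range] at hi ⊢
    refine ⟨(hy i hi.1).1, ?_⟩
    by_contra hne
    exact hF i (y i) ⟨hi.1, (hy i hi.1).1, (hy i hi.1).2, hi.2, Nat.one_le_iff_ne_zero.2 hne⟩
  have h₁ : ((Finset.range n).filter fun i => F (x i) = 0).card ≤
      ∑ s ∈ (Finset.range m).filter fun s => F s = 0, cap s := by
    rw [Finset.card_eq_sum_card_fiberwise hmem]
    refine Finset.sum_le_sum fun s hs => ?_
    rw [Finset.mem_filter, Finset.mem_range] at hs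
    refine (Finset.card_le_card ?_).trans (hcap s hs.1)
    exact Finset.filter_subset_filter _ (Finset.filter_subset _ _)
  have h₂ : ∑ s ∈ (Finset.range (m + 1)).filter fun s => F s = 0, load n x s =
      ((Finset.range n).filter fun i => F (x i) = 0).card := by
    rw [Finset.card_eq_sum_card_fiberwise (f := x)
      (t := (Finset.range (m + 1)).filter fun s => F s = 0)]
    · refine Finset.sum_congr rfl fun s hs => ?_
      rw [Finset.mem_filter] at hs
      rw [load, Finset.filter_filter]
      congr 1
      refine Finset.filter_congr fun i _ => ⟨fun e => ⟨by rw [e]; exact hs.2, e⟩, fun e => e.2⟩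
    · intro i hi
      simp only [Finset.coe_filter, Finset.mem_range, Set.mem_ofPred_eq] at hi ⊢
      exact ⟨Nat.lt_succ_of_le (h.slot_le i hi.1), hi.2⟩
  rw [Finset.range_add_one, Finset.filter_insert, if_pos hm, Finset.sum_insert (by simp)] at h₂
  have h₃ : ∑ s ∈ (Finset.range m).filter fun s => F s = 0, load n x s =
      ∑ s ∈ (Finset.range m).filter fun s => F s = 0, cap s := by
    refine Finset.sum_congr rfl fun s hs => ?_
    rw [Finset.mem_filter, Finset.mem_range] at hs
    rw [← h.load_eq s hs.1]
    refine le_antisymm (h.load_le s hs.1) ?_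
    by_contra hlt
    have := hseed s (hF₀ s hs.1 (not_le.1 hlt))
    omega
  have := h.waiting
  omega

/-- The state while flights are moved along the pointers, on the way from the auxiliary slot, which has
one flight more in the original assignment `x₀`, to the slot `s`, which now has one flight more. Slots
of smaller rank are untouched. -/
structure Augmenting (n m : ℕ) (W : ℕ → ℕ → ℕ) (c : ℕ → ℕ → ℝ) (p : ℕ → ℝ) (F ρ x₀ : ℕ → ℕ) (s : ℕ)
    (x : ℕ → ℕ) : Prop where
  le : s ≤ m
  reached : 1 ≤ F s
  slot_le : ∀ i < n, x i ≤ m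
  window : ∀ i < n, x i < m → 1 ≤ W i (x i)
  supports : Supports n m W c x p
  load_add : ∀ t, load n x t + (if t = m then 1 else 0) = load n x₀ t + (if t = s then 1 else 0)
  unmoved : ∀ i < n, x i = x₀ i ∨ ρ s < ρ (x₀ i)

theorem Augmenting.start {x₀ : ℕ → ℕ} {r : ℕ} (h : Stage n m cap W c k x₀ p₀ L)
    (hs : Search true n m W c x₀ F₀ p₀ r F p pf pt ρ) (hm : 1 ≤ F m) :
    Augmenting n m W c p F ρ x₀ m x₀ :=
  ⟨le_rfl, hm, h.slot_le, h.window, hs.supports, fun _ => rfl, fun _ _ => .inl rfl⟩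

theorem Augmenting.step {x₀ : ℕ → ℕ} {r s : ℕ} (h : Augmenting n m W c p F ρ x₀ s x)
    (hs : Search true n m W c x₀ F₀ p₀ r F p pf pt ρ) (h₀ : F₀ s = 0) :
    ρ (pt s) < ρ s ∧
      Augmenting n m W c p F ρ x₀ (pt s) (Function.update x (pf s) (pt s)) := by
  obtain ⟨hj, ht, hW, hnew, hold, htight, hρ⟩ := hs.pointer s h.reached h₀
  simp only [newSlot, cond_true, Bool.not_true, cond_false] at hnew hold hρ
  have hxj : x (pf s) = s := by
    rcases h.unmoved _ hj with e | e
    · rw [e, hnew]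
    · rw [hnew] at e
      exact absurd e (lt_irrefl _)
  refine ⟨hρ, ht.le, hold, ?_, ?_, ?_, ?_, ?_⟩
  · intro i hi
    rcases eq_or_ne i (pf s) with rfl | hne
    · simpa using ht.le
    · simpa [Function.update_of_ne hne] using h.slot_le i hi
  · intro i hi
    rcases eq_or_ne i (pf s) with rfl | hne
    · simpa using fun _ => hW
    · simpa [Function.update_of_ne hne] using h.window i hi
  · intro i hi t ht' hWt
    have := h.supports i hi t ht' hWt
    rcases eq_or_ne i (pf s) with rfl | hne
    · simp only [slack, Function.update_self, hxj, hnew] at this htight ⊢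
      linarith
    · simpa [slack, Function.update_of_ne hne] using this
  · intro t
    have h1 := load_update hj x (pt s) t
    have h2 := h.load_add t
    rw [hxj] at h1
    omega
  · intro i hi
    rcases eq_or_ne i (pf s) with rfl | hne
    · right
      rwa [hnew]
    · rw [Function.update_of_ne hne]
      rcases h.unmoved i hi with e | e
      · exact .inl e
      · exact .inr (hρ.trans e)

theorem Augmenting.finish {x₀ : ℕ → ℕ} {r s : ℕ} (h : Augmenting n m W c p F ρ x₀ s x)
    (hst : Stage n m cap W c k x₀ p₀ L) (hs : Search true n m W c x₀ F₀ p₀ r F p pf pt ρ)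
    (hcap : cap m = 0) (hF₀ : ∀ s < m, L s < cap s → 1 ≤ F₀ s) (hL : L s < cap s) :
    Stage n m cap W c (k + 1) x p (Function.update L s (L s + 1)) := by
  have hsm : s < m := by
    refine lt_of_le_of_ne h.le ?_
    rintro rfl
    omega
  refine ⟨h.slot_le, h.window, ?_, ?_, ?_, ?_, ?_, h.supports⟩
  · intro t ht
    have h1 := h.load_add t
    have h2 := hst.load_eq t ht
    rw [if_neg ht.ne] at h1
    rcases eq_or_ne t s with rfl | hne
    · rw [Function.update_self]
      simp at h1
      omega
    · rw [Function.update_of_ne hne]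
      simp [hne] at h1
      omega
  · intro t ht
    rcases eq_or_ne t s with rfl | hne
    · simpa using hL
    · simpa [Function.update_of_ne hne] using hst.load_le t ht
  · have h1 := h.load_add m
    have h2 := hst.waiting
    simp [hsm.ne'] at h1
    omega
  · intro t
    exact (hst.price_nonneg t).trans (hs.price_up rfl t)
  · intro t ht hlt
    have hlt' : L t < cap t := by
      rcases eq_or_ne t s with rfl | hne
      · exact hL
      · rwa [Function.update_of_ne hne] at hlt
    rw [hs.seed_price t (hF₀ t ht hlt'), hst.price_zero t ht hlt']

/-- What the arrays hold at the end: an equilibrium with a ranking that certifies minimum prices. -/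
structure Solved (n m : ℕ) (cap : ℕ → ℕ) (W : ℕ → ℕ → ℕ) (c : ℕ → ℕ → ℝ) (x : ℕ → ℕ) (p : ℕ → ℝ)
    (ρ : ℕ → ℕ) : Prop where
  slot_lt : ∀ i < n, x i < m
  window : ∀ i < n, 1 ≤ W i (x i)
  load_le : ∀ s < m, load n x s ≤ cap s
  price_nonneg : ∀ s < m, 0 ≤ p s
  price_zero : ∀ s < m, load n x s < cap s → p s = 0
  supports : Supports n m W c x p
  tight : ∀ s < m, p s = 0 ∨ ∃ j < n, 1 ≤ W j s ∧ ρ (x j) < ρ s ∧ slack c x p j s = 0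

theorem Stage.slot_lt (h : Stage n m cap W c n x p L) (i : ℕ) (hi : i < n) : x i < m := by
  refine lt_of_le_of_ne (h.slot_le i hi) fun e => ?_
  have h0 : load n x m = 0 := by
    have := h.waiting
    omega
  rw [load, Finset.card_eq_zero] at h0
  have : i ∈ (Finset.range n).filter fun i => x i = m := by simp [hi, e]
  rw [h0] at this
  simp at this

/-- The phantom flight `n` sits in the auxiliary slot, at price zero, and can land in every slot without
delay: its claim to minimum cost is the nonnegativity of all prices. -/
theorem Stage.supports_phantom (h : Stage n m cap W c n x p L) (hc : ∀ s, c n s = 0)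
    {W' : ℕ → ℕ → ℕ} (hW : ∀ j < n, W' j = W j) :
    Supports (n + 1) m W' c (Function.update x n m) (Function.update p m 0) := by
  intro j hj t ht hWt
  rcases Nat.lt_succ_iff_lt_or_eq.1 hj with hj | rfl
  · have := h.supports j hj t ht (by rwa [← hW j hj])
    simpa [slack, Function.update_of_ne hj.ne, Function.update_of_ne ht.ne,
      Function.update_of_ne (h.slot_lt j hj).ne] using this
  · simpa [slack, hc, Function.update_of_ne ht.ne] using h.price_nonneg t

theorem Stage.solved {x₀ : ℕ → ℕ} (h : Stage n m cap W c n x₀ p₀ L) (hc : ∀ s, c n s = 0)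
    {W' : ℕ → ℕ → ℕ} (hW : ∀ j < n, W' j = W j) (hWn : ∀ t < m, 1 ≤ W' n t)
    (hx : x = Function.update x₀ n m)
    (hF₀ : ∀ s < m, F₀ s = 0) (hF₀m : 1 ≤ F₀ m)
    (hs : Search false (n + 1) m W' c x F₀ (Function.update p₀ m 0) (m + 1) F p pf pt ρ) :
    Solved n m cap W c x p ρ := by
  have hxn : x n = m := by simp [hx]
  have hxlt : ∀ j < n, x j = x₀ j := fun j hj => by rw [hx, Function.update_of_ne hj.ne]
  have hload : ∀ s, load n x s = load n x₀ s := fun s => by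
    unfold load
    congr 1
    refine Finset.filter_congr fun i hi => ?_
    rw [hxlt i (Finset.mem_range.1 hi)]
  have hpm : p m = 0 := by simpa using hs.seed_price m hF₀m
  have hxle : ∀ j < n + 1, x j ≤ m := by
    intro j hj
    rcases Nat.lt_succ_iff_lt_or_eq.1 hj with hj | rfl
    · rw [hxlt j hj]
      exact h.slot_le j hj
    · exact hxn.le
  have hp : ∀ s < m, 0 ≤ p s := by
    intro s hs'
    have := hs.supports n (Nat.lt_succ_self n) s hs' (hWn s hs')
    simpa [slack, hxn, hpm, hc] using this
  -- the phantom flight forms a candidate pair with every slot that has not been reached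
  have hall : ∀ s < m, 1 ≤ F s := by
    intro s hs'
    by_contra h0
    refine hs.closed hxle n s ⟨Nat.lt_succ_self n, hs', hWn s hs', ?_, ?_⟩
    · simpa [newSlot] using h0
    · simpa [newSlot, hxn] using hs.seed m hF₀m
  refine ⟨fun i hi => ?_, fun i hi => ?_, fun s hs' => ?_, hp, fun s hs' hlt => ?_, ?_, ?_⟩
  · rw [hxlt i hi]
    exact h.slot_lt i hi
  · rw [hxlt i hi]
    exact h.window i hi (h.slot_lt i hi)
  · rw [hload, ← h.load_eq s hs']
    exact h.load_le s hs'
  · rw [hload, ← h.load_eq s hs'] at hlt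
    have h1 := hs.price_down rfl s
    rw [Function.update_of_ne hs'.ne, h.price_zero s hs' hlt] at h1
    exact le_antisymm h1 (hp s hs')
  · intro j hj t ht hWt
    exact hs.supports j (hj.trans (Nat.lt_succ_self n)) t ht (by rwa [hW j hj])
  · intro s hs'
    obtain ⟨hj, ht, hWs, hnew, hold, htight, hρ⟩ := hs.pointer s (hall s hs') (hF₀ s hs')
    simp only [newSlot, cond_false, Bool.not_false, cond_true] at hnew hold hρ
    rw [hnew] at hWs htight
    rcases Nat.lt_succ_iff_lt_or_eq.1 hj with hj | hj
    · right
      exact ⟨pf s, hj, by rwa [← hW _ hj], hρ, htight⟩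
    · left
      simpa [slack, hj, hxn, hpm, hc] using htight

end

/-! ### The program -/

/- Names of the arrays of natural numbers: the input (sizes, capacities, windows), the output (whether
there is an outcome, the slots of the flights), the loads of the slots, the state of a search (reached
slots, pointers), the best candidate pair, the end of an augmenting path, and loop counters. -/
local notation "aSize" => 0
local notation "aCap" => 1
local notation "aWindow" => 2
local notation "aSolved" => 3
local notation "aSlot" => 4
local notation "aLoad" => 5
local notation "aReached" => 6
local notation "aFlightPtr" => 7
local notation "aSlotPtr" => 8
local notation "aFound" => 9
local notation "aBestFlight" => 10
local notation "aBestSlot" => 11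
local notation "aEnd" => 12
local notation "aInitLoop" => 13
local notation "aStageLoop" => 14
local notation "aSeedLoop" => 15
local notation "aRoundLoop" => 16
local notation "aFlightLoop" => 17
local notation "aSlotLoop" => 18
local notation "aShiftLoop" => 19
local notation "aPhantomLoop" => 20
local notation "aClearLoop" => 21

/- Names of the arrays of real numbers: delay costs, prices, the slack of the best candidate pair. -/
local notation "rDelay" => 0
local notation "rPrice" => 1
local notation "rBest" => 2

open NatExpr

/-- The number of flights. -/
def flightsExpr : NatExpr := cell aSize

/-- The number of slots, which is also the index of the auxiliary slot. -/
def slotsExpr : NatExpr := .read aSize (.const 0) (.const 1)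

/-- The expression for `newSlot`. -/
def newSlotExpr (up : Bool) (j t : NatExpr) : NatExpr := bif up then entry aSlot j else t

/-- The expression for `slack`. -/
def slackExpr (j t : NatExpr) : RealExpr :=
  .sub (.add (.read rPrice (.const 0) t) (.read rDelay j t))
    (.add (.read rPrice (.const 0) (entry aSlot j)) (.read rDelay j (entry aSlot j)))

/-- The test for a candidate pair that beats the best one so far. -/
def improvesTest (up : Bool) (j t : NatExpr) : Test :=
  .and (.natLe (.const 1) (.read aWindow j t))
    (.and (.natLe (entry aReached (newSlotExpr up j t)) (.const 0))
      (.and (.natLe (.const 1) (entry aReached (newSlotExpr (!up) j t)))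
        (.not (.and (.natLe (.const 1) (cell aFound))
          (.realLe (.read rBest (.const 0) (.const 0)) (slackExpr j t))))))

/-- Find a candidate pair of least slack. -/
def findBest (up : Bool) : Program :=
  .seq (.setNat aFound (.const 0) (.const 0) (.const 0))
    (.forLoop aFlightLoop flightsExpr
      (.forLoop aSlotLoop slotsExpr
        (.ite (improvesTest up (cell aFlightLoop) (cell aSlotLoop))
          (.seq (.setNat aFound (.const 0) (.const 0) (.const 1))
            (.seq (.setReal rBest (.const 0) (.const 0)
                (slackExpr (cell aFlightLoop) (cell aSlotLoop)))
              (.seq (.setNat aBestFlight (.const 0) (.const 0) (cell aFlightLoop))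
                (.setNat aBestSlot (.const 0) (.const 0) (cell aSlotLoop)))))
          .skip)))

/-- Shift the prices of all slots that have not been reached. -/
def shiftPrices (up : Bool) : Program :=
  .forLoop aShiftLoop (.add slotsExpr (.const 1))
    (.ite (.natLe (entry aReached (cell aShiftLoop)) (.const 0))
      (.setReal rPrice (.const 0) (cell aShiftLoop)
        (bif up then
          .add (.read rPrice (.const 0) (cell aShiftLoop)) (.read rBest (.const 0) (.const 0))
        else
          .sub (.read rPrice (.const 0) (cell aShiftLoop)) (.read rBest (.const 0) (.const 0))))
      .skip)

/-- Record the new end of the best candidate pair as reached, with pointers to the pair. -/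
def reachBest (up : Bool) : Program :=
  .seq (.setNat aFlightPtr (.const 0) (newSlotExpr up (cell aBestFlight) (cell aBestSlot))
      (cell aBestFlight))
    (.seq (.setNat aSlotPtr (.const 0) (newSlotExpr up (cell aBestFlight) (cell aBestSlot))
        (cell aBestSlot))
      (.setNat aReached (.const 0) (newSlotExpr up (cell aBestFlight) (cell aBestSlot)) (.const 1)))

/-- One round of a search. -/
def searchRound (up : Bool) : Program :=
  .seq (findBest up)
    (.ite (.natLe (.const 1) (cell aFound)) (.seq (shiftPrices up) (reachBest up)) .skip)

/-- The search from the slots that are marked as reached. -/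
def search (up : Bool) : Program :=
  .forLoop aRoundLoop (.add slotsExpr (.const 1)) (searchRound up)

/-- Mark the slots that are not filled to capacity as reached. -/
def seedUnfilled : Program :=
  .forLoop aSeedLoop (.add slotsExpr (.const 1))
    (.ite (.natLe (entry aCap (cell aSeedLoop)) (entry aLoad (cell aSeedLoop)))
      (.setNat aReached (.const 0) (cell aSeedLoop) (.const 0))
      (.setNat aReached (.const 0) (cell aSeedLoop) (.const 1)))

/-- Move flights along the pointers, from the auxiliary slot to an unfilled one. The auxiliary slot
passes the test for filled slots, because the entries of index `m` in the arrays of capacities and loads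
are both zero. -/
def augment : Program :=
  .seq (.setNat aEnd (.const 0) (.const 0) slotsExpr)
    (.seq
      (.while (.natLe (entry aCap (cell aEnd)) (entry aLoad (cell aEnd)))
        (.seq (.setNat aSlot (.const 0) (entry aFlightPtr (cell aEnd)) (entry aSlotPtr (cell aEnd)))
          (.setNat aEnd (.const 0) (.const 0) (entry aSlotPtr (cell aEnd)))))
      (.setNat aLoad (.const 0) (cell aEnd) (.add (entry aLoad (cell aEnd)) (.const 1))))

/-- Find a place for one more flight, or discover that there is no landing schedule. -/
def assignFlight : Program :=
  .ite (.natLe (.const 1) (cell aSolved))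
    (.seq seedUnfilled
      (.seq (search true)
        (.ite (.natLe (.const 1) (entry aReached slotsExpr)) augment
          (.setNat aSolved (.const 0) (.const 0) (.const 0)))))
    .skip

/-- Put all flights into the auxiliary slot. -/
def placeFlights : Program :=
  .seq (.forLoop aInitLoop flightsExpr (.setNat aSlot (.const 0) (cell aInitLoop) slotsExpr))
    (.setNat aSolved (.const 0) (.const 0) (.const 1))

/-- Lower the prices to the minimum, by a search from the auxiliary slot with the phantom flight. The
phantom is added to the input arrays as flight number `n`: its delay costs are zero already. -/
def lowerPrices : Program :=
  .seq (.setNat aSlot (.const 0) flightsExpr slotsExpr)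
    (.seq (.forLoop aPhantomLoop slotsExpr
        (.setNat aWindow flightsExpr (cell aPhantomLoop) (.const 1)))
      (.seq (.setNat aSize (.const 0) (.const 0) (.add flightsExpr (.const 1)))
        (.seq (.setReal rPrice (.const 0) slotsExpr .zero)
          (.seq (.forLoop aClearLoop slotsExpr
              (.setNat aReached (.const 0) (cell aClearLoop) (.const 0)))
            (.seq (.setNat aReached (.const 0) slotsExpr (.const 1))
              (search false))))))

/-- The program that computes the outcome of the mechanism. -/
def landingProgram : Program :=
  .seq placeFlights
    (.seq (.forLoop aStageLoop flightsExpr assignFlight)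
      (.ite (.natLe (.const 1) (cell aSolved)) lowerPrices .skip))

/-! ### Correctness and running time of the program -/

@[simp] theorem eval_flightsExpr (σ : Memory) : flightsExpr.eval σ = σ.nat aSize 0 0 := rfl

@[simp] theorem eval_slotsExpr (σ : Memory) : slotsExpr.eval σ = σ.nat aSize 0 1 := rfl

@[simp] theorem eval_newSlotExpr (σ : Memory) (up : Bool) (j t : NatExpr) :
    (newSlotExpr up j t).eval σ = newSlot up (σ.nat aSlot 0) (j.eval σ) (t.eval σ) := by
  cases up <;> rfl

@[simp] theorem eval_slackExpr (σ : Memory) (j t : NatExpr) :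
    (slackExpr j t).eval σ =
      slack (σ.real rDelay) (σ.nat aSlot 0) (σ.real rPrice 0) (j.eval σ) (t.eval σ) := rfl

/-- `bj`, `bt` is a candidate pair whose slack `δ` is least among the candidate pairs in `D`; or,
if `found` is zero, there is no candidate pair in `D`. -/
def IsBest (up : Bool) (N m : ℕ) (W : ℕ → ℕ → ℕ) (c : ℕ → ℕ → ℝ) (x F : ℕ → ℕ) (p : ℕ → ℝ)
    (D : ℕ → ℕ → Prop) (found bj bt : ℕ) (δ : ℝ) : Prop :=
  (found = 0 ∧ ∀ j t, D j t → ¬ IsCandidate up N m W x F j t) ∨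
    (1 ≤ found ∧ IsCandidate up N m W x F bj bt ∧ δ = slack c x p bj bt ∧
      ∀ j t, D j t → IsCandidate up N m W x F j t → δ ≤ slack c x p j t)

theorem IsBest.congr {up : Bool} {N m : ℕ} {W : ℕ → ℕ → ℕ} {c : ℕ → ℕ → ℝ} {x F : ℕ → ℕ}
    {p : ℕ → ℝ} {D D' : ℕ → ℕ → Prop} {found bj bt : ℕ} {δ : ℝ}
    (h : IsBest up N m W c x F p D found bj bt δ)
    (hD : ∀ j t, IsCandidate up N m W x F j t → D' j t → D j t) :
    IsBest up N m W c x F p D' found bj bt δ := by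
  rcases h with ⟨h0, h⟩ | ⟨h1, h2, h3, h⟩
  · exact .inl ⟨h0, fun j t hd hc => h j t (hD j t hc hd) hc⟩
  · exact .inr ⟨h1, h2, h3, fun j t hd hc => h j t (hD j t hc hd) hc⟩

open Program

theorem findBest_ensures {B N m : ℕ} (up : Bool) {σ : Memory} (hN : σ.nat aSize 0 0 = N)
    (hm : σ.nat aSize 0 1 = m) (hNB : N ≤ B) (hmB : m ≤ B) :
    Ensures B (findBest up) σ fun τ =>
      IsBest up N m (σ.nat aWindow) (σ.real rDelay) (σ.nat aSlot 0) (σ.nat aReached 0)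
        (σ.real rPrice 0) (fun _ _ => True)
        (τ.nat aFound 0 0) (τ.nat aBestFlight 0 0) (τ.nat aBestSlot 0 0) (τ.real rBest 0 0) := by
  refine .seq (.setNat ((Ensures.forLoop (N := N) (I := fun k τ =>
      IsBest up N m (σ.nat aWindow) (σ.real rDelay) (σ.nat aSlot 0) (σ.nat aReached 0)
        (σ.real rPrice 0) (fun j _ => j < k)
        (τ.nat aFound 0 0) (τ.nat aBestFlight 0 0) (τ.nat aBestSlot 0 0) (τ.real rBest 0 0))
      hNB ?_ ?_ ?_).imp ?_))
  · intro τ hτ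
    simp [hτ.nat_eq aSize, hN]
  · left
    simp
  · intro k hk τ hτ hkτ hI
    refine (Ensures.forLoop (N := m) (I := fun l υ =>
      IsBest up N m (σ.nat aWindow) (σ.real rDelay) (σ.nat aSlot 0) (σ.nat aReached 0)
        (σ.real rPrice 0) (fun j t => j < k ∨ j = k ∧ t < l)
        (υ.nat aFound 0 0) (υ.nat aBestFlight 0 0) (υ.nat aBestSlot 0 0) (υ.real rBest 0 0))
      hmB ?_ ?_ ?_).imp ?_
    · intro υ hυ
      simp [hυ.nat_eq aSize, hτ.nat_eq aSize, hm]
    · simpa using hI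
    · intro l hl υ hυ hlυ hI
      have h2 : υ.nat aWindow = σ.nat aWindow := by
        simp [hυ.nat_eq aWindow, hτ.nat_eq aWindow]
      have h4 : υ.nat aSlot = σ.nat aSlot := by
        simp [hυ.nat_eq aSlot, hτ.nat_eq aSlot]
      have h6 : υ.nat aReached = σ.nat aReached := by
        simp [hυ.nat_eq aReached, hτ.nat_eq aReached]
      have h17 : υ.nat aFlightLoop 0 0 = k := by
        simp [hυ.nat_eq aFlightLoop, hkτ]
      have h0 : υ.real rDelay = σ.real rDelay := by
        simp [hυ.real_eq rDelay, hτ.real_eq rDelay]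
      have h1 : υ.real rPrice = σ.real rPrice := by
        simp [hυ.real_eq rPrice, hτ.real_eq rPrice]
      refine .ite (fun hb => ?_) (fun hb => ?_)
      · refine .seq (.setNat (.seq (.setReal (.seq (.setNat (.setNat ?_))))))
        simp only [improvesTest, Test.holds_and, Test.holds_natLe, Test.holds_not, Test.holds_realLe,
          eval_const, eval_read, eval_cell, eval_entry, eval_newSlotExpr, eval_slackExpr,
          RealExpr.eval_read, h2, h4, h6, h17, h0, h1, hlυ] at hb
        obtain ⟨hb1, hb2, hb3, hb4⟩ := hb
        have hcand : IsCandidate up N m (σ.nat aWindow) (σ.nat aSlot 0) (σ.nat aReached 0) k l :=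
          ⟨hk, hl, hb1, by omega, hb3⟩
        right
        simp [h17, hlυ, h0, h1, h4]
        refine ⟨hcand, fun j t hjt hc => ?_⟩
        have hold : j < k ∨ j = k ∧ t < l → slack (σ.real rDelay) (σ.nat aSlot 0)
            (σ.real rPrice 0) k l ≤ slack (σ.real rDelay) (σ.nat aSlot 0) (σ.real rPrice 0) j t := by
          intro hjt
          rcases hI with ⟨-, hI⟩ | ⟨hf, -, -, hI⟩
          · exact absurd hc (hI j t hjt)
          · exact (not_le.1 fun h => hb4 ⟨hf, h⟩).le.trans (hI j t hjt hc)
        rcases hjt with hjt | ⟨hj, hjt⟩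
        · exact hold (.inl hjt)
        · rcases Nat.lt_or_eq_of_le hjt with hjt | hjt
          · exact hold (.inr ⟨hj, hjt⟩)
          · rw [hj, hjt]
      · refine .skip ?_
        simp only [improvesTest, Test.holds_and, Test.holds_natLe, Test.holds_not, Test.holds_realLe,
          eval_const, eval_read, eval_cell, eval_entry, eval_newSlotExpr, eval_slackExpr,
          RealExpr.eval_read, h2, h4, h6, h17, h0, h1, hlυ] at hb
        simp
        rcases hI with ⟨hf, hI⟩ | ⟨hf, h2, h3, hI⟩
        · refine .inl ⟨hf, fun j t hjt hc => ?_⟩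
          rcases hjt with hjt | ⟨rfl, hjt⟩
          · exact hI j t (.inl hjt) hc
          · rcases Nat.lt_or_eq_of_le hjt with hjt | rfl
            · exact hI j t (.inr ⟨rfl, hjt⟩) hc
            · obtain ⟨-, -, h3, h4, h5⟩ := hc
              exact hb ⟨h3, h4.le, h5, by omega⟩
        · refine .inr ⟨hf, h2, h3, fun j t hjt hc => ?_⟩
          rcases hjt with hjt | ⟨rfl, hjt⟩
          · exact hI j t (.inl hjt) hc
          · rcases Nat.lt_or_eq_of_le hjt with hjt | rfl
            · exact hI j t (.inr ⟨rfl, hjt⟩) hc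
            · obtain ⟨-, -, h3, h4, h5⟩ := hc
              by_contra hlt
              exact hb ⟨h3, h4.le, h5, fun h => hlt h.2⟩
    · intro υ hυ h
      simp
      refine h.congr fun j t hc hj => ?_
      rcases Nat.lt_or_eq_of_le hj with hj | hj
      · exact .inl hj
      · exact .inr ⟨hj, hc.2.1⟩
  · intro τ hτ h
    exact h.congr fun j t hc _ => hc.1

theorem shiftPrices_ensures {B m : ℕ} (up : Bool) {σ : Memory} (hm : σ.nat aSize 0 1 = m)
    (hmB : m + 1 ≤ B) :
    Ensures B (shiftPrices up) σ fun τ => τ.real rPrice 0 = fun s =>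
      if s < m + 1 ∧ σ.nat aReached 0 s = 0 then shift up (σ.real rPrice 0 s) (σ.real rBest 0 0)
      else σ.real rPrice 0 s := by
  refine Ensures.forLoop (I := fun k τ => τ.real rPrice 0 = fun s =>
      if s < k ∧ σ.nat aReached 0 s = 0 then shift up (σ.real rPrice 0 s) (σ.real rBest 0 0)
      else σ.real rPrice 0 s) hmB ?_ ?_ ?_
  · intro τ hτ
    simp [hτ.nat_eq aSize, hm]
  · simp
  · intro k hk τ hτ hkτ hI
    have h6 : τ.nat aReached = σ.nat aReached := hτ.nat_eq aReached
    have h2 : τ.real rBest = σ.real rBest := hτ.real_eq rBest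
    refine .ite (fun hb => .setReal ?_) (fun hb => .skip ?_)
    · simp [hkτ, h6] at hb
      have heval : (bif up then
          .add (.read rPrice (.const 0) (cell aShiftLoop)) (.read rBest (.const 0) (.const 0))
        else
          .sub (.read rPrice (.const 0) (cell aShiftLoop)) (.read rBest (.const 0) (.const 0)) :
          RealExpr).eval τ = shift up (σ.real rPrice 0 k) (σ.real rBest 0 0) := by
        cases up <;> simp [shift, hkτ, hI, h2]
      rw [heval]
      simp only [eval_const, eval_cell, hkτ, Memory.real_setNat, Memory.real_setReal_same, hI]
      funext s
      rcases eq_or_ne s k with rfl | hs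
      · simp [hb]
      · have : s < k + 1 ↔ s < k := by omega
        simp [Function.update_of_ne hs, this]
    · simp [hkτ, h6] at hb
      simp only [Memory.real_setNat, hI]
      funext s
      rcases eq_or_ne s k with rfl | hs
      · simp [hb]
      · have : s < k + 1 ↔ s < k := by omega
        simp [this]

theorem searchRound_ensures {B N m r : ℕ} {up : Bool} {F₀ : ℕ → ℕ} {p₀ : ℕ → ℝ} {ρ : ℕ → ℕ}
    {σ : Memory} (hN : σ.nat aSize 0 0 = N) (hm : σ.nat aSize 0 1 = m) (hNB : N ≤ B)
    (hmB : m + 1 ≤ B) (hx : ∀ j < N, σ.nat aSlot 0 j ≤ m)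
    (h : Search up N m (σ.nat aWindow) (σ.real rDelay) (σ.nat aSlot 0) F₀ p₀ r
      (σ.nat aReached 0) (σ.real rPrice 0) (σ.nat aFlightPtr 0) (σ.nat aSlotPtr 0) ρ) :
    Ensures B (searchRound up) σ fun τ => ∃ ρ',
      Search up N m (σ.nat aWindow) (σ.real rDelay) (σ.nat aSlot 0) F₀ p₀ (r + 1)
        (τ.nat aReached 0) (τ.real rPrice 0) (τ.nat aFlightPtr 0) (τ.nat aSlotPtr 0) ρ' := by
  refine .seq ((findBest_ensures up hN hm hNB (by omega)).imp fun τ hτ hbest => ?_)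
  have e0 : τ.nat aSize = σ.nat aSize := hτ.nat_eq aSize
  have e4 : τ.nat aSlot = σ.nat aSlot := hτ.nat_eq aSlot
  have e6 : τ.nat aReached = σ.nat aReached := hτ.nat_eq aReached
  have e7 : τ.nat aFlightPtr = σ.nat aFlightPtr := hτ.nat_eq aFlightPtr
  have e8 : τ.nat aSlotPtr = σ.nat aSlotPtr := hτ.nat_eq aSlotPtr
  have e1 : τ.real rPrice = σ.real rPrice := hτ.real_eq rPrice
  refine .ite (fun hb => ?_) (fun hb => .skip ?_)
  · refine .seq ((shiftPrices_ensures up (m := m) (by rw [e0, hm]) hmB).imp fun υ hυ hp => ?_)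
    rcases hbest with ⟨h0, -⟩ | ⟨-, hcand, hδ, hmin⟩
    · simp [h0] at hb
    have f4 : υ.nat aSlot = σ.nat aSlot := (hυ.nat_eq aSlot).trans e4
    have f6 : υ.nat aReached = σ.nat aReached := (hυ.nat_eq aReached).trans e6
    have f7 : υ.nat aFlightPtr = σ.nat aFlightPtr := (hυ.nat_eq aFlightPtr).trans e7
    have f8 : υ.nat aSlotPtr = σ.nat aSlotPtr := (hυ.nat_eq aSlotPtr).trans e8
    have f10 : υ.nat aBestFlight = τ.nat aBestFlight := hυ.nat_eq aBestFlight
    have f11 : υ.nat aBestSlot = τ.nat aBestSlot := hυ.nat_eq aBestSlot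
    refine .seq (.setNat (.seq (.setNat (.setNat ?_))))
    have := h.succ hx hcand hδ fun j t => hmin j t trivial
    refine ⟨Function.update ρ (newSlot up (σ.nat aSlot 0) (τ.nat aBestFlight 0 0)
      (τ.nat aBestSlot 0 0)) (r + 1), ?_⟩
    simpa [f4, f6, f7, f8, f10, f11, hp, e6, e1] using this
  · rcases hbest with ⟨-, hno⟩ | ⟨h1, -⟩
    · refine ⟨ρ, ?_⟩
      rw [e6, e7, e8, e1]
      exact h.succ_of_closed fun j t => hno j t trivial
    · exact absurd h1 hb

theorem search_ensures {B N m : ℕ} (up : Bool) {σ : Memory} (hN : σ.nat aSize 0 0 = N)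
    (hm : σ.nat aSize 0 1 = m) (hNB : N ≤ B) (hmB : m + 1 ≤ B) (hx : ∀ j < N, σ.nat aSlot 0 j ≤ m)
    (h : Supports N m (σ.nat aWindow) (σ.real rDelay) (σ.nat aSlot 0) (σ.real rPrice 0)) :
    Ensures B (search up) σ fun τ => ∃ ρ,
      Search up N m (σ.nat aWindow) (σ.real rDelay) (σ.nat aSlot 0) (σ.nat aReached 0)
        (σ.real rPrice 0) (m + 1)
        (τ.nat aReached 0) (τ.real rPrice 0) (τ.nat aFlightPtr 0) (τ.nat aSlotPtr 0) ρ := by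
  refine Ensures.forLoop (I := fun r τ => ∃ ρ,
      Search up N m (σ.nat aWindow) (σ.real rDelay) (σ.nat aSlot 0) (σ.nat aReached 0)
        (σ.real rPrice 0) r
        (τ.nat aReached 0) (τ.real rPrice 0) (τ.nat aFlightPtr 0) (τ.nat aSlotPtr 0) ρ)
    hmB ?_ ?_ ?_
  · intro τ hτ
    simp [hτ.nat_eq aSize, hm]
  · exact ⟨_, by simpa using Search.start _ _ h⟩
  · rintro r hr τ hτ - ⟨ρ, hI⟩
    have e0 : τ.nat aSize = σ.nat aSize := hτ.nat_eq aSize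
    have e2 : τ.nat aWindow = σ.nat aWindow := hτ.nat_eq aWindow
    have e4 : τ.nat aSlot = σ.nat aSlot := hτ.nat_eq aSlot
    have er : τ.real rDelay = σ.real rDelay := hτ.real_eq rDelay
    rw [← e2, ← e4, ← er] at hI ⊢
    refine (searchRound_ensures (by rw [e0, hN]) (by rw [e0, hm]) hNB hmB
      (by rwa [e4]) hI).imp ?_
    rintro υ - ⟨ρ', h'⟩
    exact ⟨ρ', by simpa using h'⟩

theorem seedUnfilled_ensures {B m : ℕ} {σ : Memory} (hm : σ.nat aSize 0 1 = m) (hmB : m + 1 ≤ B) :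
    Ensures B seedUnfilled σ fun τ =>
      ∀ s < m + 1, 1 ≤ τ.nat aReached 0 s ↔ σ.nat aLoad 0 s < σ.nat aCap 0 s := by
  refine Ensures.forLoop (I := fun k τ =>
      ∀ s < k, 1 ≤ τ.nat aReached 0 s ↔ σ.nat aLoad 0 s < σ.nat aCap 0 s) hmB ?_ ?_ ?_
  · intro τ hτ
    simp [hτ.nat_eq aSize, hm]
  · simp
  · intro k hk τ hτ hkτ hI
    have h1 : τ.nat aCap = σ.nat aCap := hτ.nat_eq aCap
    have h5 : τ.nat aLoad = σ.nat aLoad := hτ.nat_eq aLoad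
    refine .ite (fun hb => .setNat ?_) (fun hb => .setNat ?_)
    all_goals
      simp [hkτ, h1, h5] at hb
      intro s hs
      rcases Nat.lt_succ_iff_lt_or_eq.1 hs with hs | rfl
      · simpa [hkτ, Function.update_of_ne hs.ne] using hI s hs
      · simp [hkτ, hb]

theorem augment_ensures {B n m k : ℕ} {F₀ ρ : ℕ → ℕ} {p₀ : ℕ → ℝ} {σ : Memory}
    (hm : σ.nat aSize 0 1 = m) (hmB : m + 1 ≤ B) (hcap : σ.nat aCap 0 m = 0)
    (hF₀ : ∀ s < m + 1, 1 ≤ F₀ s ↔ σ.nat aLoad 0 s < σ.nat aCap 0 s)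
    (h : Stage n m (σ.nat aCap 0) (σ.nat aWindow) (σ.real rDelay) k (σ.nat aSlot 0) p₀
      (σ.nat aLoad 0))
    (hs : Search true n m (σ.nat aWindow) (σ.real rDelay) (σ.nat aSlot 0) F₀ p₀ (m + 1)
      (σ.nat aReached 0) (σ.real rPrice 0) (σ.nat aFlightPtr 0) (σ.nat aSlotPtr 0) ρ)
    (hreach : 1 ≤ σ.nat aReached 0 m) :
    Ensures B augment σ fun τ =>
      Stage n m (σ.nat aCap 0) (σ.nat aWindow) (σ.real rDelay) (k + 1) (τ.nat aSlot 0)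
        (σ.real rPrice 0) (τ.nat aLoad 0) := by
  refine .seq (.setNat (.seq ((Ensures.loop (v := ρ m) (I := fun v τ => v = ρ (τ.nat aEnd 0 0) ∧
    Augmenting n m (σ.nat aWindow) (σ.real rDelay) (σ.real rPrice 0) (σ.nat aReached 0) ρ
      (σ.nat aSlot 0) (τ.nat aEnd 0 0) (τ.nat aSlot 0))
    ((hs.rank_le m).trans hmB) ?_ ?_).imp ?_)))
  · simpa [hm] using Augmenting.start h hs hreach
  -- the rank of the current end of the path bounds the number of moves that are left
  · rintro v τ hτ ⟨rfl, hI⟩ hb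
    have e1 : τ.nat aCap = σ.nat aCap := by simp [hτ.nat_eq aCap]
    have e5 : τ.nat aLoad = σ.nat aLoad := by simp [hτ.nat_eq aLoad]
    have e7 : τ.nat aFlightPtr = σ.nat aFlightPtr := by simp [hτ.nat_eq aFlightPtr]
    have e8 : τ.nat aSlotPtr = σ.nat aSlotPtr := by simp [hτ.nat_eq aSlotPtr]
    simp only [Test.holds_natLe, eval_entry, eval_cell, e1, e5] at hb
    have h0 : F₀ (τ.nat aEnd 0 0) = 0 := by
      by_contra hne
      have := (hF₀ _ (Nat.lt_succ_of_le hI.le)).1 (Nat.one_le_iff_ne_zero.2 hne)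
      omega
    obtain ⟨hlt, hI'⟩ := hI.step hs h0
    refine .seq (.setNat (.setNat ⟨_, hlt, ?_⟩))
    simpa [e7, e8] using hI'
  · rintro τ hτ ⟨⟨v, -, hI⟩, hb⟩
    have e1 : τ.nat aCap = σ.nat aCap := by simp [hτ.nat_eq aCap]
    have e5 : τ.nat aLoad = σ.nat aLoad := by simp [hτ.nat_eq aLoad]
    simp only [Test.holds_natLe, eval_entry, eval_cell, e1, e5, not_le] at hb
    refine .setNat ?_
    simpa [e5] using hI.finish h hs hcap (fun s hs => (hF₀ s (by omega)).2) hb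

theorem placeFlights_ensures {B n m : ℕ} {σ : Memory} (hn : σ.nat aSize 0 0 = n)
    (hm : σ.nat aSize 0 1 = m) (hnB : n ≤ B) :
    Ensures B placeFlights σ fun τ =>
      (∀ i < n, τ.nat aSlot 0 i = m) ∧ τ.nat aSolved 0 0 = 1 := by
  refine .seq ((Ensures.forLoop (N := n) (I := fun k τ => ∀ i < k, τ.nat aSlot 0 i = m)
    hnB ?_ ?_ ?_).imp ?_)
  · intro τ hτ
    simp [hτ.nat_eq aSize, hn]
  · simp
  · intro k hk τ hτ hkτ hI
    refine .setNat ?_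
    intro i hi
    rcases Nat.lt_succ_iff_lt_or_eq.1 hi with hi | rfl
    · simpa [hkτ, Function.update_of_ne hi.ne] using hI i hi
    · simp [hkτ, hτ.nat_eq aSize, hm]
  · intro τ hτ h
    exact .setNat ⟨by simpa using h, by simp⟩

theorem assignFlight_ensures {B n m k : ℕ} {σ : Memory} (hn : σ.nat aSize 0 0 = n)
    (hm : σ.nat aSize 0 1 = m) (hnB : n ≤ B) (hmB : m + 1 ≤ B) (hcap : σ.nat aCap 0 m = 0)
    (hk : k < n)
    (h : σ.nat aSolved 0 0 = 0 ∧ ¬ Feasible n m (σ.nat aCap 0) (σ.nat aWindow) ∨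
      σ.nat aSolved 0 0 = 1 ∧ Stage n m (σ.nat aCap 0) (σ.nat aWindow) (σ.real rDelay) k
        (σ.nat aSlot 0) (σ.real rPrice 0) (σ.nat aLoad 0)) :
    Ensures B assignFlight σ fun τ =>
      τ.nat aSolved 0 0 = 0 ∧ ¬ Feasible n m (σ.nat aCap 0) (σ.nat aWindow) ∨
      τ.nat aSolved 0 0 = 1 ∧ Stage n m (σ.nat aCap 0) (σ.nat aWindow) (σ.real rDelay) (k + 1)
        (τ.nat aSlot 0) (τ.real rPrice 0) (τ.nat aLoad 0) := by
  refine .ite (fun hb => ?_) (fun hb => ?_)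
  · simp at hb
    obtain ⟨h1, h⟩ := h.resolve_left (by rintro ⟨h0, -⟩; omega)
    refine .seq ((seedUnfilled_ensures hm hmB).imp fun τ hτ hseed => ?_)
    have e0 : τ.nat aSize = σ.nat aSize := hτ.nat_eq aSize
    have e1 : τ.nat aCap = σ.nat aCap := hτ.nat_eq aCap
    have e2 : τ.nat aWindow = σ.nat aWindow := hτ.nat_eq aWindow
    have e3 : τ.nat aSolved = σ.nat aSolved := hτ.nat_eq aSolved
    have e4 : τ.nat aSlot = σ.nat aSlot := hτ.nat_eq aSlot
    have e5 : τ.nat aLoad = σ.nat aLoad := hτ.nat_eq aLoad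
    have er : τ.real = σ.real := by
      funext a
      exact hτ.real a (by simp [seedUnfilled, forLoop, realWrites])
    have hsup : Supports n m (τ.nat aWindow) (τ.real rDelay) (τ.nat aSlot 0) (τ.real rPrice 0) := by
      rw [e2, e4, er]
      exact h.supports
    refine .seq ((search_ensures true (by rw [e0, hn]) (by rw [e0, hm]) hnB hmB
      (by rw [e4]; exact h.slot_le) hsup).imp ?_)
    rintro υ hυ ⟨ρ, hs⟩
    have f0 : υ.nat aSize = σ.nat aSize := (hυ.nat_eq aSize).trans e0
    have f1 : υ.nat aCap = σ.nat aCap := (hυ.nat_eq aCap).trans e1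
    have f2 : υ.nat aWindow = σ.nat aWindow := (hυ.nat_eq aWindow).trans e2
    have f3 : υ.nat aSolved = σ.nat aSolved := (hυ.nat_eq aSolved).trans e3
    have f4 : υ.nat aSlot = σ.nat aSlot := (hυ.nat_eq aSlot).trans e4
    have f5 : υ.nat aLoad = σ.nat aLoad := (hυ.nat_eq aLoad).trans e5
    have fr : υ.real rDelay = σ.real rDelay := by rw [hυ.real_eq rDelay, er]
    rw [e2, e4, er] at hs
    refine .ite (fun hb => ?_) (fun hb => ?_)
    · simp only [Test.holds_natLe, eval_const, eval_entry, eval_slotsExpr, f0, hm] at hb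
      refine (augment_ensures (k := k) (F₀ := τ.nat aReached 0) (p₀ := σ.real rPrice 0) (ρ := ρ)
        (by rw [f0, hm]) hmB (by rw [f1, hcap]) (by rwa [f1, f5])
        (by rwa [f1, f2, f4, f5, fr]) (by rwa [f2, f4, fr]) hb).imp fun ω hω hst => .inr ⟨?_, ?_⟩
      · rw [hω.nat_eq aSolved, f3, h1]
      · rwa [f1, f2, fr, ← hω.real_eq rPrice] at hst
    · simp only [Test.holds_natLe, eval_const, eval_entry, eval_slotsExpr, f0, hm] at hb
      refine .setNat (.inl ⟨by simp, ?_⟩)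
      exact h.not_feasible hk (fun s hs' => (hseed s (by omega)).2) hs.seed (hs.closed h.slot_le)
        (by omega)
  · simp at hb
    refine .skip (.inl ?_)
    exact h.resolve_right (by rintro ⟨h1, -⟩; omega)

theorem lowerPrices_ensures {B n m : ℕ} {σ : Memory} (hn : σ.nat aSize 0 0 = n)
    (hm : σ.nat aSize 0 1 = m) (hB : n + m + 1 ≤ B) (hc : ∀ s, σ.real rDelay n s = 0)
    (h : Stage n m (σ.nat aCap 0) (σ.nat aWindow) (σ.real rDelay) n (σ.nat aSlot 0)
      (σ.real rPrice 0) (σ.nat aLoad 0)) :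
    Ensures B lowerPrices σ fun τ => ∃ ρ,
      Solved n m (σ.nat aCap 0) (σ.nat aWindow) (σ.real rDelay) (τ.nat aSlot 0)
        (τ.real rPrice 0) ρ := by
  refine .seq (.setNat (.seq ((Ensures.forLoop (N := m) (I := fun k τ =>
    (∀ j < n, τ.nat aWindow j = σ.nat aWindow j) ∧ ∀ t < k, 1 ≤ τ.nat aWindow n t)
    (by omega) ?_ ?_ ?_).imp ?_)))
  · intro τ hτ
    simp [hτ.nat_eq aSize, hm]
  · simp
  · rintro k hk τ hτ hkτ ⟨hI, hI'⟩
    have en : τ.nat aSize = σ.nat aSize := by simp [hτ.nat_eq aSize]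
    refine .setNat ⟨fun j hj => ?_, fun t ht => ?_⟩
    · rw [← hI j hj]
      funext t
      simp [Memory.setNat, en, hn, hj.ne]
    · rcases Nat.lt_succ_iff_lt_or_eq.1 ht with ht | rfl
      · simpa [en, hn, hkτ, Function.update_of_ne ht.ne] using hI' t ht
      · simp [en, hn, hkτ]
  · rintro τ hτ ⟨hW, hWn⟩
    have e0 : τ.nat aSize = σ.nat aSize := by simp [hτ.nat_eq aSize]
    have e4 : τ.nat aSlot 0 = Function.update (σ.nat aSlot 0) n m := by
      simp [hτ.nat_eq aSlot, hn, hm]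
    have er : τ.real = σ.real := by
      funext a
      simp [hτ.real a (by simp [forLoop, realWrites])]
    refine .seq (.setNat (.seq (.setReal (.seq ((Ensures.forLoop (N := m)
      (I := fun k υ => ∀ s < k, υ.nat aReached 0 s = 0) (by omega) ?_ ?_ ?_).imp ?_)))))
    · intro υ hυ
      simp [hυ.nat_eq aSize, e0, hm]
    · simp
    · intro k hk υ hυ hkυ hI
      refine .setNat fun s hs => ?_
      rcases Nat.lt_succ_iff_lt_or_eq.1 hs with hs | rfl
      · simpa [hkυ, Function.update_of_ne hs.ne] using hI s hs
      · simp [hkυ]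
    · intro υ hυ hF
      have f0 : υ.nat aSize 0 = Function.update (σ.nat aSize 0) 0 (n + 1) := by
        simp [hυ.nat_eq aSize, e0, hn]
      have f2 : υ.nat aWindow = τ.nat aWindow := by simp [hυ.nat_eq aWindow]
      have f4 : υ.nat aSlot 0 = Function.update (σ.nat aSlot 0) n m := by
        simp [hυ.nat_eq aSlot, e4]
      have fd : υ.real rDelay = σ.real rDelay := by
        simp [hυ.real_eq rDelay, er]
      have fp : υ.real rPrice 0 = Function.update (σ.real rPrice 0) m 0 := by
        simp [hυ.real_eq rPrice, e0, hm, er]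
      refine .seq (.setNat ?_)
      have hs := h.supports_phantom hc hW
      have hmm : υ.nat aSize 0 1 = m := by simp [f0, hm]
      refine (search_ensures (N := n + 1) (m := m) false (by simp [f0]) (by simp [hmm]) (by omega)
        (by omega) (fun j hj => ?_) (by simpa [f2, f4, fd, fp] using hs)).imp ?_
      · rcases Nat.lt_succ_iff_lt_or_eq.1 hj with hj | rfl
        · simpa [f4, Function.update_of_ne hj.ne] using h.slot_le j hj
        · simp [f4]
      · rintro ω hω ⟨ρ, hsearch⟩
        have g4 : ω.nat aSlot 0 = Function.update (σ.nat aSlot 0) n m := by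
          simp [hω.nat_eq aSlot, f4]
        refine ⟨ρ, h.solved hc hW hWn g4 (F₀ := Function.update (υ.nat aReached 0) m 1)
          (F := ω.nat aReached 0) (pf := ω.nat aFlightPtr 0) (pt := ω.nat aSlotPtr 0) ?_ ?_ ?_⟩
        · intro s hs'
          rw [Function.update_of_ne hs'.ne]
          exact hF s hs'
        · simp
        · simpa [f2, f4, fd, fp, g4, hmm] using hsearch

/-- Besides the input, the initial memory has to hold zeros: as the capacity of the auxiliary slot, as
loads and prices, and as the delay costs of all flights in the auxiliary slot and of the phantom flight
`n` in all slots. -/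
theorem landingProgram_ensures {n m : ℕ} {σ : Memory} (hn : σ.nat aSize 0 0 = n)
    (hm : σ.nat aSize 0 1 = m) (hcap : σ.nat aCap 0 m = 0) (hL : σ.nat aLoad 0 = fun _ => 0)
    (hp : σ.real rPrice 0 = fun _ => 0) (hcm : ∀ i < n, σ.real rDelay i m = 0)
    (hcn : ∀ s, σ.real rDelay n s = 0)
    (hc : ∀ i < n, ∀ s < m, 1 ≤ σ.nat aWindow i s → 0 ≤ σ.real rDelay i s) :
    Ensures (n + m + 1) landingProgram σ fun τ =>
      τ.nat aSolved 0 0 = 0 ∧ ¬ Feasible n m (σ.nat aCap 0) (σ.nat aWindow) ∨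
      τ.nat aSolved 0 0 = 1 ∧ ∃ ρ,
        Solved n m (σ.nat aCap 0) (σ.nat aWindow) (σ.real rDelay) (τ.nat aSlot 0)
          (τ.real rPrice 0) ρ := by
  refine .seq ((placeFlights_ensures hn hm (by omega)).imp ?_)
  rintro τ hτ ⟨hx, h3⟩
  have e0 : τ.nat aSize = σ.nat aSize := hτ.nat_eq aSize
  have e1 : τ.nat aCap = σ.nat aCap := hτ.nat_eq aCap
  have e2 : τ.nat aWindow = σ.nat aWindow := hτ.nat_eq aWindow
  have e5 : τ.nat aLoad = σ.nat aLoad := hτ.nat_eq aLoad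
  have er : τ.real = σ.real := by
    funext a
    exact hτ.real a (by simp [placeFlights, forLoop, realWrites])
  refine .seq ((Ensures.forLoop (N := n) (I := fun k υ =>
      υ.nat aSolved 0 0 = 0 ∧ ¬ Feasible n m (σ.nat aCap 0) (σ.nat aWindow) ∨
      υ.nat aSolved 0 0 = 1 ∧ Stage n m (σ.nat aCap 0) (σ.nat aWindow) (σ.real rDelay) k
        (υ.nat aSlot 0) (υ.real rPrice 0) (υ.nat aLoad 0)) (by omega) ?_ ?_ ?_).imp ?_)
  · intro υ hυ
    simp [hυ.nat_eq aSize, e0, hn]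
  · right
    simpa [h3, e5, hL, er, hp] using Stage.start hx hcm hc
  · intro k hk υ hυ hkυ hI
    have f0 : υ.nat aSize = σ.nat aSize := (hυ.nat_eq aSize).trans e0
    have f1 : υ.nat aCap = σ.nat aCap := (hυ.nat_eq aCap).trans e1
    have f2 : υ.nat aWindow = σ.nat aWindow := (hυ.nat_eq aWindow).trans e2
    have fr : υ.real rDelay = σ.real rDelay := by rw [hυ.real_eq rDelay, er]
    rw [← f1, ← f2, ← fr] at hI ⊢
    refine (assignFlight_ensures (by rw [f0, hn]) (by rw [f0, hm]) (by omega) (by omega)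
      (by rw [f1, hcap]) hk hI).imp fun ω _ h => ?_
    simpa using h
  · intro υ hυ hI
    have f0 : υ.nat aSize = σ.nat aSize := (hυ.nat_eq aSize).trans e0
    have f1 : υ.nat aCap = σ.nat aCap := (hυ.nat_eq aCap).trans e1
    have f2 : υ.nat aWindow = σ.nat aWindow := (hυ.nat_eq aWindow).trans e2
    have fr : υ.real rDelay = σ.real rDelay := by rw [hυ.real_eq rDelay, er]
    refine .ite (fun hb => ?_) (fun hb => ?_)
    · simp at hb
      obtain ⟨h1, hst⟩ := hI.resolve_left (by rintro ⟨h0, -⟩; omega)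
      rw [← f1, ← f2, ← fr] at hst ⊢
      refine (lowerPrices_ensures (by rw [f0, hn]) (by rw [f0, hm]) le_rfl
        (by rwa [fr]) hst).imp fun ω hω h => .inr ⟨?_, h⟩
      rw [hω.nat_eq aSolved, h1]
    · simp at hb
      exact .skip (.inl (hI.resolve_right (by rintro ⟨h1, -⟩; omega)))

/-! ### The mechanism -/

theorem card_filter_fin_eq_load {n m : ℕ} (x : Fin n → Fin m) (y : ℕ → ℕ)
    (h : ∀ i : Fin n, y i = x i) (s : Fin m) :
    (Finset.univ.filter fun i => x i = s).card = load n y s := by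
  rw [load, Finset.card_filter, Finset.card_filter,
    ← Fin.sum_univ_eq_sum_range (fun i => if y i = s then 1 else 0)]
  simp only [h, Fin.ext_iff]

section

variable {n m : ℕ} (cap : Fin m → ℕ+) (R : Fin n → Report (Fin m))

theorem inputMemory_cap (s : Fin m) : (inputMemory cap R).nat aCap 0 s = cap s := by
  simp [inputMemory]

theorem inputMemory_window (i : Fin n) (s : Fin m) :
    1 ≤ (inputMemory cap R).nat aWindow i s ↔ s ∈ (R i).window := by
  by_cases h : s ∈ (R i).window <;> simp [inputMemory, h]

theorem inputMemory_delay {i : Fin n} {s : Fin m} (h : s ∈ (R i).window) :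
    (inputMemory cap R).real rDelay i s = (R i).delay s := by
  simp [inputMemory, h]

theorem feasible_inputMemory {x : Fin n → Fin m} (hx : IsLandingSchedule cap R x) :
    Feasible n m ((inputMemory cap R).nat aCap 0) ((inputMemory cap R).nat aWindow) := by
  have hy : ∀ i : Fin n, (fun i => if h : i < n then (x ⟨i, h⟩ : ℕ) else 0) (i : ℕ) = x i := by
    simp
  refine ⟨fun i => if h : i < n then (x ⟨i, h⟩ : ℕ) else 0, fun i hi => ?_, fun s hs => ?_⟩
  · have := hy ⟨i, hi⟩
    simp only at this ⊢
    rw [this]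
    exact ⟨(x ⟨i, hi⟩).2, (inputMemory_window cap R ⟨i, hi⟩ (x ⟨i, hi⟩)).2 (hx.1 ⟨i, hi⟩)⟩
  · rw [← card_filter_fin_eq_load x _ hy ⟨s, hs⟩, inputMemory_cap cap R ⟨s, hs⟩]
    exact hx.2 ⟨s, hs⟩

variable {cap R}

theorem Solved.isValidOutcome {x : ℕ → ℕ} {p : ℕ → ℝ} {ρ : ℕ → ℕ}
    (h : Solved n m ((inputMemory cap R).nat aCap 0) ((inputMemory cap R).nat aWindow)
      ((inputMemory cap R).real rDelay) x p ρ) :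
    IsValidOutcome cap R (some ⟨fun i => ⟨x i, h.slot_lt i i.2⟩, fun s => p s⟩) := by
  have hcard := card_filter_fin_eq_load (fun i : Fin n => (⟨x i, h.slot_lt i i.2⟩ : Fin m)) x
    fun _ => rfl
  have hwin : ∀ i : Fin n, (⟨x i, h.slot_lt i i.2⟩ : Fin m) ∈ (R i).window := fun i =>
    (inputMemory_window cap R i ⟨x i, _⟩).1 (h.window i i.2)
  have hslack : ∀ (i : Fin n) (s : Fin m), s ∈ (R i).window →
      slack ((inputMemory cap R).real rDelay) x p i s =
        (p s + (R i).delay s) - (p (x i) + (R i).delay ⟨x i, h.slot_lt i i.2⟩) := by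
    intro i s hs
    rw [slack, inputMemory_delay cap R hs, ← inputMemory_delay cap R (hwin i)]
  have heq : IsEquilibrium cap R (fun i => ⟨x i, h.slot_lt i i.2⟩) fun s => p s := by
    refine ⟨⟨hwin, fun s => ?_⟩, fun s => h.price_nonneg s s.2, fun i s hs => ?_, fun s hs => ?_⟩
    · rw [hcard, ← inputMemory_cap cap R]
      exact h.load_le s s.2
    · have := h.supports i i.2 s s.2 ((inputMemory_window cap R i s).2 hs)
      rw [hslack i s hs] at this
      exact sub_nonneg.1 this
    · rw [hcard, ← inputMemory_cap cap R] at hs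
      exact h.price_zero s s.2 hs
  have htight : IsTightRanking R (fun i : Fin n => (⟨x i, h.slot_lt i i.2⟩ : Fin m))
      (fun s => p s) fun s => ρ s := by
    intro s
    rcases h.tight s s.2 with h0 | ⟨j, hj, hW, hρ, hsl⟩
    · exact .inl h0
    · have hs := (inputMemory_window cap R ⟨j, hj⟩ s).1 hW
      refine .inr ⟨⟨j, hj⟩, hs, hρ, ?_⟩
      rw [hslack ⟨j, hj⟩ s hs] at hsl
      exact sub_eq_zero.1 hsl
  exact ⟨heq, heq.isMinimumPrices htight, heq.isEfficient, heq.isVCGPayment htight⟩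

variable (cap R)

theorem exists_outcome : ∃ (o : Option (Outcome n m)) (t : ℕ) (τ : Memory),
    Runs landingProgram (inputMemory cap R) t τ ∧ t ≤ landingProgram.cost.eval (n + m + 1) ∧
      Displays τ o ∧ IsValidOutcome cap R o := by
  have h : Ensures (n + m + 1) landingProgram (inputMemory cap R) _ :=
    landingProgram_ensures (n := n) (m := m) (by simp [inputMemory]) (by simp [inputMemory])
      (by simp [inputMemory]) (by funext s; simp [inputMemory]) (by funext s; simp [inputMemory])
      (fun i _ => by simp [inputMemory]) (fun s => by simp [inputMemory])
      (fun i hi s hs hW => by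
        have hw := (inputMemory_window cap R ⟨i, hi⟩ ⟨s, hs⟩).1 hW
        rw [inputMemory_delay cap R (i := ⟨i, hi⟩) (s := ⟨s, hs⟩) hw]
        exact (R ⟨i, hi⟩).delay_nonneg _ hw)
  obtain ⟨t, τ, hr, ht, ⟨h0, hno⟩ | ⟨h1, ρ, hs⟩⟩ := h
  · exact ⟨none, t, τ, hr, ht, h0, fun ⟨x, hx⟩ => hno (feasible_inputMemory cap R hx)⟩
  · exact ⟨some ⟨fun i => ⟨τ.nat aSlot 0 i, hs.slot_lt i i.2⟩, fun s => τ.real rPrice 0 s⟩,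
      t, τ, hr, ht, ⟨h1, fun _ => rfl, fun _ => rfl⟩, hs.isValidOutcome⟩

end

/-- The mechanism that announces what the program displays. -/
noncomputable def landingMechanism : Mechanism := fun _ _ cap R => (exists_outcome cap R).choose

theorem landingMechanism_isValidOutcome (n m : ℕ) (cap : Fin m → ℕ+) (R : Fin n → Report (Fin m)) :
    IsValidOutcome cap R (landingMechanism n m cap R) := by
  obtain ⟨t, τ, -, -, -, h⟩ := (exists_outcome cap R).choose_spec
  exact h

theorem landingMechanism_isCombinatorialStronglyPolynomial :
    IsCombinatorialStronglyPolynomial landingMechanism := by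
  refine ⟨landingProgram, landingProgram.cost.comp (Polynomial.X + 1), fun n m cap R => ?_⟩
  obtain ⟨t, τ, hr, ht, hd, -⟩ := (exists_outcome cap R).choose_spec
  exact ⟨t, τ, hr, by simpa using ht, hd⟩

end LandingMarket

theorem theorem5 :
    ∃ M : LandingMarket.Mechanism,
      (∀ (n m : ℕ) (cap : Fin m → ℕ+) (R : Fin n → LandingMarket.Report (Fin m)),
        (M n m cap R = none → ¬ ∃ x : Fin n → Fin m, LandingMarket.IsLandingSchedule cap R x) ∧
        (∀ o : LandingMarket.Outcome n m, M n m cap R = some o →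
          LandingMarket.IsEquilibrium cap R o.slot o.price ∧
          LandingMarket.IsMinimumPrices cap R o.price ∧
          LandingMarket.IsEfficient cap R o.slot ∧
          ∀ i : Fin n, LandingMarket.IsVCGPayment cap R o.slot i (o.price (o.slot i)))) ∧
      LandingMarket.IsDominantStrategyIC M ∧
      LandingMarket.IsCombinatorialStronglyPolynomial M := by
  refine ⟨LandingMarket.landingMechanism, fun n m cap R => ⟨fun h => ?_, fun o h => ?_⟩,
    LandingMarket.isDominantStrategyIC_of_isValidOutcome
      LandingMarket.landingMechanism_isValidOutcome,
    LandingMarket.landingMechanism_isCombinatorialStronglyPolynomial⟩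
  · have := LandingMarket.landingMechanism_isValidOutcome n m cap R
    rwa [h] at this
  · have := LandingMarket.landingMechanism_isValidOutcome n m cap R
    rwa [h] at this
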